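/- Let $d\ge 0$ be an integer, let $(\Omega,\mathcal F,\mathbb P)$ be a probability space with an ergodic (in particular measure-preserving) action $\tau=(\tau_k)_{k\in\mathbb Z^d}$ of $\mathbb Z^d$, let $\mathcal H=L^2(\mathbb R^d;\mathbb C)$, $(U_kf)(x)=f(x+k)$ for $k\in\mathbb Z^d$, $Q=[-\tfrac12,\tfrac12)^d$, and let $P_j=-i\partial_{x_j}$ on $D(P_j)=\{\varphi\in\mathcal H:\partial_{x_j}\varphi\in\mathcal H\}$. A measurable function $f$ on $\Omega\times\mathbb R^d$ is called stationary if, for every $k\in\mathbb Z^d$, $f(\tau_k\omega,x)=f(\omega,x+k)$ for almost all $(\omega,x)$; $L^1_s$ and $H^1_s$ denote the spaces of stationary functions in $L^1(\Omega,L^1_{\rm loc}(\mathbb R^d))$ and in $L^2(\Omega,H^1_{\rm loc}(\mathbb R^d))$, respectively. A random operator $B$ is called locally trace class if $\mathbb E\,\mathrm{Tr}\,|\chi B\chi|<\infty$ for every $\chi\in L^\infty_c(\mathbb R^d)$ (bounded with compact support), and then its trace per unit volume is $\underline{\mathrm{Tr}}(B)=\mathbb E\,\mathrm{Tr}(\mathbf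 1_QB\mathbf 1_Q)$. Let $A=(A(\omega))_{\omega\in\Omega}$ be a weakly measurable family of operators on $\mathcal H$ that are almost surely bounded, self-adjoint and non-negative, such that 1. $A$ is ergodic: for every $k\in\mathbb Z^d$, $A(\tau_k\omega)=U_kA(\omega)U_k^*$ almost surely; 2. $A$ is locally trace class; 3. $A$ has locally finite kinetic energy: for every $1\le j\le d$, the operator $P_jAP_j$ is locally trace class. Here $P_jA(\omega)P_j$ is understood as the sesquilinear form $(\varphi,\psi)\mapsto\langle P_j\varphi,A(\omega)P_j\psi\rangle$ on $D(P_j)$: for $\eta\in C^\infty_c(\mathbb R^d)$ the form of $\eta P_jA(\omega)P_j\eta$ is almost surely given by a bounded operator on $\mathcal H$, and for $\chi\in L^\infty_c(\mathbb R^d)$ one sets $\chi P_jAP_j\chi=\chi(\eta P_jAP_j\eta)\chi$ with any $\eta\in C^\infty_c(\mathbb R^d)$ that equals $1$ near the support of $\chi$. Then $A$ has a density $\rho_A$, that is, a function $\rho_A\in L^1_s$ such that, for every $\chi\in L^\infty_c(\mathbb R^d)$, $\mathrm{Tr}(\chi A(\omega)\chi)=\int_{\mathbb R^d}\chi(x)^2\rho_A(\omega,x)\,dx$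 almost surely; and every such $\rho_A$ satisfies $\rho_A\ge0$ almost everywhere, $$\sqrt{\rho_A}\in H^1_s\qquad\text{and}\qquad\mathbb E\left(\int_Q\left|\nabla\sqrt{\rho_A}\right|^2\right)\le\underline{\mathrm{Tr}}(-\Delta A):=\sum_{j=1}^d\underline{\mathrm{Tr}}(P_jAP_j).$$ -/

import Mathlib

open MeasureTheory Set Filter Topology
open scoped ENNReal

noncomputable section

namespace ErgodicHO

/-! ### Operators on a Hilbert space: trace and trace norm -/

section Trace

variable {H : Type*} [NormedAddCommGroup H] [InnerProductSpace ℂ H] [CompleteSpace H]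

variable (H) in
/-- The index set of a Hilbert basis of `H`, chosen once and for all. -/
def basisIndex : Set H := (exists_hilbertBasis ℂ H).choose

variable (H) in
/-- A Hilbert basis of `H`, chosen once and for all. -/
def basis : HilbertBasis (basisIndex H) ℂ H := (exists_hilbertBasis ℂ H).choose_spec.choose

/-- The trace norm `Tr |T| ∈ [0, ∞]`, where `|T| = √(T* T)`; it does not depend on the basis, and
`T` is trace class if and only if it is finite. -/
def traceNorm (T : H →L[ℂ] H) : ℝ≥0∞ :=
  ∑' i, ENNReal.ofReal (inner ℂ (basis H i) (CFC.abs T (basis H i))).re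

/-- The trace of an operator. It is only used for trace-class operators, for which the series
converges absolutely and its sum does not depend on the basis. -/
def trace (T : H →L[ℂ] H) : ℂ := ∑' i, inner ℂ (basis H i) (T (basis H i))

end Trace

/-! ### The space `L²(ℝᵈ)` and the operators on it -/

/-- Euclidean space `ℝᵈ`. -/
abbrev Space (d : ℕ) : Type := EuclideanSpace ℝ (Fin d)

/-- The Hilbert space `L²(ℝᵈ)` of complex-valued functions. -/
abbrev L2 (d : ℕ) : Type := Lp ℂ 2 (volume : Measure (Space d))

/-- The semi-open unit cube `Q = [-1/2, 1/2)ᵈ`. -/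
def unitCube (d : ℕ) : Set (Space d) := {x | ∀ i, x i ∈ Ico (-1 / 2 : ℝ) (1 / 2)}

/-- The inclusion of `ℤᵈ` in `ℝᵈ`. -/
def latticeVec {d : ℕ} (k : Fin d → ℤ) : Space d := WithLp.toLp 2 fun i => (k i : ℝ)

/-- The unitary `U_k` on `L²(ℝᵈ)`, `(U_k f)(x) = f(x + k)`. -/
def translation {d : ℕ} (k : Fin d → ℤ) : L2 d →L[ℂ] L2 d :=
  (Lp.compMeasurePreservingₗᵢ ℂ (fun x : Space d => x + latticeVec k)
    (measurePreserving_add_right volume (latticeVec k))).toContinuousLinearMap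

open Classical in
/-- The operator of multiplication by `χ ∈ L^∞(ℝᵈ)` (and `0` if `χ` is not in `L^∞`). -/
def mulOp {d : ℕ} (χ : Space d → ℂ) : L2 d →L[ℂ] L2 d :=
  if h : MemLp χ ⊤ (volume : Measure (Space d)) then
    (ContinuousLinearMap.mul ℂ ℂ).holderL volume ⊤ 2 2 (h.toLp χ)
  else 0

/-- `χ ∈ L^∞_c(ℝᵈ)`: essentially bounded, with compact support. -/
structure IsBoundedCutoff {d : ℕ} (χ : Space d → ℂ) : Prop where
  memLp : MemLp χ ⊤ (volume : Measure (Space d))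
  hasCompactSupport : HasCompactSupport χ

/-- `χ ∈ C^∞_c(ℝᵈ)`, with real or complex values. -/
structure IsTest {d : ℕ} {F : Type*} [NormedAddCommGroup F] [NormedSpace ℝ F]
    (χ : Space d → F) : Prop where
  contDiff : ContDiff ℝ ((⊤ : ℕ∞) : WithTop ℕ∞) χ
  hasCompactSupport : HasCompactSupport χ

/-- The classical partial derivative `∂_j f`. -/
def partialDeriv {d : ℕ} {F : Type*} [NormedAddCommGroup F] [NormedSpace ℝ F]
    (j : Fin d) (f : Space d → F) (x : Space d) : F :=
  fderiv ℝ f x (EuclideanSpace.single j 1)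

/-! ### The momentum operators -/

/-- The graph of `P_j = -i ∂_j`: the pairs `(φ, ψ)` in `L² × L²` with `ψ = -i ∂_j φ` in the sense of
distributions, that is, `⟨η, ψ⟩ = ⟨-i ∂_j η, φ⟩` for all `η ∈ C^∞_c`. -/
def momentumGraph {d : ℕ} (j : Fin d) : Submodule ℂ (L2 d × L2 d) where
  carrier := {p | ∀ η : Space d → ℂ, IsTest η → ∀ u v : L2 d, u =ᵐ[volume] η →
    v =ᵐ[volume] (fun x => -Complex.I * partialDeriv j η x) → inner ℂ u p.2 = inner ℂ v p.1}
  add_mem' := by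
    intro a b ha hb η hη u v hu hv
    simp only [Prod.fst_add, Prod.snd_add, inner_add_right, ha η hη u v hu hv, hb η hη u v hu hv]
  zero_mem' := by
    intro η _ u v _ _
    simp
  smul_mem' := by
    intro c a ha η hη u v hu hv
    simp only [Prod.smul_fst, Prod.smul_snd, inner_smul_right, ha η hη u v hu hv]

/-- The momentum graph is single-valued. -/
theorem momentumGraph_singleValued {d : ℕ} (j : Fin d) :
    ∀ p ∈ momentumGraph j, p.1 = 0 → p.2 = 0 := by
  intro p hp h0
  have hloc : LocallyIntegrable (p.2 : Space d → ℂ) volume :=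
    (Lp.memLp p.2).locallyIntegrable (by norm_num)
  refine Lp.ext ?_
  refine EventuallyEq.trans ?_ (Lp.coeFn_zero _ _ _).symm
  refine ae_eq_zero_of_integral_contDiff_smul_eq_zero hloc ?_
  intro g hg hgs
  have hη : IsTest (fun x => (g x : ℂ)) :=
    ⟨Complex.ofRealCLM.contDiff.comp hg, hgs.comp_left Complex.ofReal_zero⟩
  have hd : Continuous (fun x => -Complex.I * partialDeriv j (fun x => (g x : ℂ)) x) :=
    continuous_const.mul ((hη.contDiff.continuous_fderiv (by simp)).clm_apply continuous_const)
  have hds : HasCompactSupport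
      (fun x => -Complex.I * partialDeriv j (fun x => (g x : ℂ)) x) := by
    refine (hη.hasCompactSupport.fderiv (𝕜 := ℝ)).comp_left
      (g := fun L : Space d →L[ℝ] ℂ => -Complex.I * L (EuclideanSpace.single j 1)) ?_
    simp
  have hu := hη.contDiff.continuous.memLp_of_hasCompactSupport (p := 2) (μ := volume)
    hη.hasCompactSupport
  have hv := hd.memLp_of_hasCompactSupport (p := 2) (μ := volume) hds
  have h := hp _ hη (hu.toLp _) (hv.toLp _) hu.coeFn_toLp hv.coeFn_toLp
  rw [h0, inner_zero_right, L2.inner_def] at h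
  rw [← h]
  refine integral_congr_ae ?_
  filter_upwards [hu.coeFn_toLp] with x hx
  rw [hx]
  simp [mul_comm]

/-- The momentum operator `P_j = -i ∂_j`, with domain `{φ ∈ L² | ∂_j φ ∈ L²}`. -/
def momentum {d : ℕ} (j : Fin d) : L2 d →ₗ.[ℂ] L2 d := (momentumGraph j).toLinearPMap

/-- `S` is the bounded operator on `L²` given by the form `η P_j A P_j η` on `D(P_j)`, for `η ∈ C^∞_c`:
`⟨φ, S ψ⟩ = ⟨P_j (η̄ φ), A P_j (η ψ)⟩` for all `φ, ψ ∈ D(P_j)`. -/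
def IsSmoothMomentumSandwich {d : ℕ} (j : Fin d) (A : L2 d →L[ℂ] L2 d) (η : Space d → ℂ)
    (S : L2 d →L[ℂ] L2 d) : Prop :=
  ∀ φ ψ : L2 d, φ ∈ (momentum j).domain → ψ ∈ (momentum j).domain →
    ∀ φ' ψ' : (momentum j).domain, (φ' : L2 d) = mulOp (fun x => star (η x)) φ →
      (ψ' : L2 d) = mulOp η ψ → inner ℂ φ (S ψ) = inner ℂ (momentum j φ') (A (momentum j ψ'))

/-- `T` is the bounded operator `χ P_j A P_j χ`, for `χ ∈ L^∞_c`. As `P_j A P_j` maps `D(P_j)` to its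
dual, it is first localized by a smooth `η` that is `1` near the support of `χ`:
`χ P_j A P_j χ = χ (η P_j A P_j η) χ`. The result does not depend on `η`. -/
def IsMomentumSandwich {d : ℕ} (j : Fin d) (A : L2 d →L[ℂ] L2 d) (χ : Space d → ℂ)
    (T : L2 d →L[ℂ] L2 d) : Prop :=
  ∃ η : Space d → ℂ, IsTest η ∧ (∀ᶠ x in 𝓝ˢ (tsupport χ), η x = 1) ∧
    ∃ S : L2 d →L[ℂ] L2 d, IsSmoothMomentumSandwich j A η S ∧ T = mulOp χ ∘L S ∘L mulOp χ

open Classical in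
/-- The operator `χ P_j A P_j χ` (and `0` if it is not a bounded operator). -/
def momentumSandwich {d : ℕ} (j : Fin d) (A : L2 d →L[ℂ] L2 d) (χ : Space d → ℂ) :
    L2 d →L[ℂ] L2 d :=
  if h : ∃ T, IsMomentumSandwich j A χ T then h.choose else 0

/-! ### Weak gradients -/

/-- `g = ∇f` in the sense of distributions, for locally integrable `f` and `g`. -/
structure IsWeakGradient {d : ℕ} (f : Space d → ℝ) (g : Space d → Space d) : Prop where
  locallyIntegrable : LocallyIntegrable f
  locallyIntegrable_grad : LocallyIntegrable g
  integral_eq : ∀ η : Space d → ℝ, IsTest η → ∀ j : Fin d,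
    ∫ x, f x * partialDeriv j η x = -∫ x, g x j * η x

open Classical in
/-- A version of the weak gradient `∇f`, which is unique almost everywhere (and `0` if there is
none). -/
def weakGradient {d : ℕ} (f : Space d → ℝ) : Space d → Space d :=
  if h : ∃ g, IsWeakGradient f g then h.choose else 0

/-! ### Stationary functions and ergodic operators -/

section Random

variable {Ω : Type*} [MeasurableSpace Ω] {d : ℕ} (μ : Measure Ω)

/-- `f` is a stationary function on `Ω × ℝᵈ`: it is measurable and, for every `k ∈ ℤᵈ`,
`f(τ_k ω, x) = f(ω, x + k)` almost surely and almost everywhere. -/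
structure IsStationaryFun [AddAction (Fin d → ℤ) Ω] (f : Ω → Space d → ℝ) : Prop where
  aestronglyMeasurable : AEStronglyMeasurable (fun p : Ω × Space d => f p.1 p.2) (μ.prod volume)
  shift : ∀ k : Fin d → ℤ, ∀ᵐ p ∂(μ.prod (volume : Measure (Space d))),
    f (k +ᵥ p.1) p.2 = f p.1 (p.2 + latticeVec k)

/-- The space `L¹_s` of stationary functions in `L¹(Ω, L¹_loc)`. -/
structure MemL1s [AddAction (Fin d → ℤ) Ω] (f : Ω → Space d → ℝ) : Prop
    extends IsStationaryFun μ f where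
  lintegral_lt_top : ∀ K : Set (Space d), IsCompact K → ∫⁻ ω, ∫⁻ x in K, ‖f ω x‖ₑ ∂volume ∂μ < ⊤

/-- The space `H¹_s` of stationary functions in `L²(Ω, H¹_loc)`. -/
structure MemH1s [AddAction (Fin d → ℤ) Ω] (f : Ω → Space d → ℝ) : Prop
    extends IsStationaryFun μ f where
  exists_gradient : ∃ g : Ω → Space d → Space d,
    AEStronglyMeasurable (fun p : Ω × Space d => g p.1 p.2) (μ.prod volume) ∧
    (∀ᵐ ω ∂μ, IsWeakGradient (f ω) (g ω)) ∧
    ∀ K : Set (Space d), IsCompact K →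
      ∫⁻ ω, ∫⁻ x in K, (‖f ω x‖ₑ ^ 2 + ‖g ω x‖ₑ ^ 2) ∂volume ∂μ < ⊤

/-- `A` is an ergodic (stationary) random operator: it is weakly measurable and, for every `k ∈ ℤᵈ`,
`A(τ_k ω) = U_k A(ω) U_k*` almost surely. -/
structure IsErgodicOperator [AddAction (Fin d → ℤ) Ω] (A : Ω → L2 d →L[ℂ] L2 d) : Prop where
  aemeasurable : ∀ φ ψ : L2 d, AEMeasurable (fun ω => inner ℂ ψ (A ω φ)) μ
  shift : ∀ k : Fin d → ℤ, ∀ᵐ ω ∂μ,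
    A (k +ᵥ ω) = translation k ∘L A ω ∘L ContinuousLinearMap.adjoint (translation k)

/-- `A` is locally trace class: `χ A χ ∈ L¹(Ω, 𝔖₁)` for all `χ ∈ L^∞_c`. -/
def IsLocallyTraceClass (A : Ω → L2 d →L[ℂ] L2 d) : Prop :=
  ∀ χ : Space d → ℂ, IsBoundedCutoff χ → ∫⁻ ω, traceNorm (mulOp χ ∘L A ω ∘L mulOp χ) ∂μ < ⊤

/-- The kinetic energy of `A` is locally finite: `P_j A P_j` is locally trace class for every `j`, that
is, `χ P_j A P_j χ` is almost surely a bounded operator and is in `L¹(Ω, 𝔖₁)`, for all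
`χ ∈ L^∞_c`. -/
def HasLocallyFiniteKineticEnergy (A : Ω → L2 d →L[ℂ] L2 d) : Prop :=
  ∀ (j : Fin d) (χ : Space d → ℂ), IsBoundedCutoff χ →
    (∀ᵐ ω ∂μ, ∃ T, IsMomentumSandwich j (A ω) χ T) ∧
      ∫⁻ ω, traceNorm (momentumSandwich j (A ω) χ) ∂μ < ⊤

/-- The average kinetic energy per unit volume of `A`, that is, the sum over `j` of the trace per
unit volume of `P_j A P_j`, which is `𝔼 Tr (1_Q P_j A P_j 1_Q)`. -/
def kineticEnergyPerUnitVolume (A : Ω → L2 d →L[ℂ] L2 d) : ℝ :=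
  ∑ j : Fin d, ∫ ω, (trace (momentumSandwich j (A ω) ((unitCube d).indicator 1))).re ∂μ

/-- `ρ` is (a version of) the density `ρ_A` of `A`: the function in `L¹_s` such that, for all
`χ ∈ L^∞_c`, `Tr (χ A χ) = ∫ χ² ρ` almost surely. -/
structure IsDensity [AddAction (Fin d → ℤ) Ω] (A : Ω → L2 d →L[ℂ] L2 d)
    (ρ : Ω → Space d → ℝ) : Prop extends MemL1s μ ρ where
  trace_eq : ∀ χ : Space d → ℂ, IsBoundedCutoff χ → ∀ᵐ ω ∂μ,
    trace (mulOp χ ∘L A ω ∘L mulOp χ) = ∫ x, χ x ^ 2 * (ρ ω x : ℂ)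

end Random

end ErgodicHO

end

open ErgodicHO

/-! For a positive operator `A`, the density is `ρ = ∑ₙ |√A eₙ|²` for a Hilbert basis `eₙ`. The
Hilbert–Schmidt norm is invariant under adjoints, so `Tr (χAχ) = ‖√A χ‖² = ‖χ √A‖² = ∫ χ² ρ` for
real `χ` (`traceNorm_mulOp_comp`; `trace_mulOp_comp` treats complex `χ`).

The inequality is first proved for a fixed operator, on a set `s` that is open up to a null set. If
`T = 1_s P_j A P_j 1_s` is bounded, then `√A P_j`, defined on test functions, extends to a bounded
`C` with `⟨ψ, Tψ⟩ = ‖Cψ‖²` (`IsMomentumSandwich.exists_sqrt_momentum`). On the open set, `C* eₙ` is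
the distribution `P_j √A eₙ`, and `∑ ‖C* eₙ‖² = ∑ ‖C eₙ‖² = Tr T`. Cauchy–Schwarz gives `|∂_j √ρ|² ≤
∑ₙ |∂_j √A eₙ|²` pointwise, and integration bounds the left side by `Tr T`
(`hasWeakPartialOn_sqrt_tsum`, `IsMomentumSandwich.exists_weakPartial`). Taking `s` to be the unit
cube and averaging over `ω` gives the stated bound; large balls give the local `H¹` property.

The remaining difficulty is measurability in `ω`, since `√A(ω)` and the chosen sandwich operators
are not given measurably. Mollified densities are traces of `χAχ`, hence measurable in `ω` and
continuous in `x`; their limsup is a jointly measurable density (`jointDensity`). Likewise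
`limGradient` recovers the gradient from mollifications by a formula that is measurable in all
variables. Any other density has the same mollifications at countably many points, hence agrees
almost everywhere (`IsDensity.ae_eq_density`). -/

noncomputable section

namespace ErgodicHO

/-! ### Traces, Hilbert–Schmidt sums and square roots on an abstract Hilbert space. -/

section AbstractTrace

set_option linter.unusedSectionVars false

variable {H : Type*} [NormedAddCommGroup H] [InnerProductSpace ℂ H] [CompleteSpace H]

/-- Distinct orthonormal vectors are at distance `√2`, so the balls of radius `1/2` around them are
disjoint open sets. Countability of the basis lets sums over it be integrated termwise and
almost-sure statements be collected over it. -/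
theorem countable_of_orthonormal [SecondCountableTopology H] {ι : Type*} {v : ι → H}
    (hv : Orthonormal ℂ v) : Countable ι := by
  have hd : Pairwise (Function.onFun Disjoint fun i => Metric.ball (v i) (1 / 2)) := by
    intro i j hij
    refine Metric.ball_disjoint_ball ?_
    have h : ‖v i - v j‖ ^ 2 = 2 := by
      rw [@norm_sub_sq ℂ, hv.1, hv.1, hv.2 hij]; norm_num
    rw [dist_eq_norm]
    nlinarith [norm_nonneg (v i - v j)]
  have := Set.PairwiseDisjoint.countable_of_isOpen (s := fun i => Metric.ball (v i) (1 / 2))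
    (a := Set.univ) (fun i _ j _ hij => hd hij) (fun i _ => Metric.isOpen_ball)
    (fun i _ => ⟨v i, by simp⟩)
  exact Set.countable_univ_iff.mp this

instance countable_basisIndex [SecondCountableTopology H] : Countable (basisIndex H) :=
  countable_of_orthonormal (basis H).orthonormal

/-- Parseval's identity with values in `[0, ∞]`, where double sums can be exchanged without
summability conditions. -/
theorem tsum_enorm_inner_sq (x : H) : ∑' i, ‖inner ℂ (basis H i) x‖ₑ ^ 2 = ‖x‖ₑ ^ 2 := by
  have h := (basis H).hasSum_inner_mul_inner x x
  have h2 : HasSum (fun i => ‖inner ℂ (basis H i) x‖ ^ 2) (‖x‖ ^ 2) := by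
    have h3 := Complex.hasSum_re h
    have e : (inner ℂ x x : ℂ).re = ‖x‖ ^ 2 := by
      simpa using inner_self_eq_norm_sq (𝕜 := ℂ) x
    rw [e] at h3
    convert! h3 using 2 with i
    have h4 := inner_mul_symm_re_eq_norm (𝕜 := ℂ) x (basis H i)
    rw [norm_mul, norm_inner_symm, ← sq] at h4
    exact h4.symm
  have h3 := ENNReal.ofReal_tsum_of_nonneg (fun i => by positivity) h2.summable
  rw [h2.tsum_eq] at h3
  simpa [ENNReal.ofReal_pow, ofReal_norm] using h3.symm

/-- The Hilbert–Schmidt norm of an operator and of its adjoint agree. -/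
theorem tsum_enorm_apply_sq_adjoint (S : H →L[ℂ] H) :
    ∑' i, ‖S (basis H i)‖ₑ ^ 2 = ∑' i, ‖S.adjoint (basis H i)‖ₑ ^ 2 := by
  simp_rw [← tsum_enorm_inner_sq (S _), ← tsum_enorm_inner_sq (S.adjoint _)]
  rw [ENNReal.tsum_comm]
  refine tsum_congr fun i => tsum_congr fun j => ?_
  rw [ContinuousLinearMap.adjoint_inner_right, enorm_eq_iff_norm_eq.mpr (norm_inner_symm _ _)]

theorem traceNorm_of_isPositive {T : H →L[ℂ] H} (hT : T.IsPositive) :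
    traceNorm T = ∑' i, ENNReal.ofReal (inner ℂ (basis H i) (T (basis H i))).re := by
  rw [traceNorm, CFC.abs_of_nonneg T ((ContinuousLinearMap.nonneg_iff_isPositive T).mpr hT)]

theorem inner_eq_re_of_isPositive {T : H →L[ℂ] H} (hT : T.IsPositive) (x : H) :
    ((inner ℂ x (T x) : ℂ).re : ℂ) = inner ℂ x (T x) :=
  Complex.ext rfl
    (Complex.nonneg_iff.mp (hT.inner_nonneg_right x)).2

theorem re_inner_nonneg_of_isPositive {T : H →L[ℂ] H} (hT : T.IsPositive) (x : H) :
    0 ≤ (inner ℂ x (T x) : ℂ).re := by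
  simpa using hT.re_inner_nonneg_right x

theorem trace_eq_ofReal_tsum {T : H →L[ℂ] H} (hT : T.IsPositive) :
    trace T = ((∑' i, (inner ℂ (basis H i) (T (basis H i)) : ℂ).re : ℝ) : ℂ) := by
  rw [Complex.ofReal_tsum, trace]
  exact tsum_congr fun i => (inner_eq_re_of_isPositive hT (basis H i)).symm

/-- For a positive trace-class operator the trace is the trace norm. -/
theorem ofReal_trace_re {T : H →L[ℂ] H} (hT : T.IsPositive) (hfin : traceNorm T ≠ ⊤) :
    ENNReal.ofReal (trace T).re = traceNorm T := by
  rw [traceNorm_of_isPositive hT] at hfin ⊢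
  have hs : Summable fun i => (inner ℂ (basis H i) (T (basis H i)) : ℂ).re := by
    refine (ENNReal.summable_toReal hfin).congr fun i => ?_
    rw [ENNReal.toReal_ofReal (re_inner_nonneg_of_isPositive hT _)]
  rw [← ENNReal.ofReal_tsum_of_nonneg (fun i => re_inner_nonneg_of_isPositive hT _) hs,
    trace_eq_ofReal_tsum hT, Complex.ofReal_re]

theorem trace_re_nonneg {T : H →L[ℂ] H} (hT : T.IsPositive) : 0 ≤ (trace T).re := by
  rw [trace_eq_ofReal_tsum hT, Complex.ofReal_re]
  exact tsum_nonneg fun i => re_inner_nonneg_of_isPositive hT _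

theorem norm_inner_apply_prod_summable {S : H →L[ℂ] H} (hS : ∑' i, ‖S (basis H i)‖ₑ ^ 2 ≠ ⊤) :
    Summable fun p : basisIndex H × basisIndex H =>
      ‖(inner ℂ (basis H p.2) (S (basis H p.1)) : ℂ)‖ ^ 2 := by
  have : ∑' p : basisIndex H × basisIndex H,
      ‖(inner ℂ (basis H p.2) (S (basis H p.1)) : ℂ)‖ₑ ^ 2 ≠ ⊤ := by
    rw [ENNReal.tsum_prod']
    simpa only [tsum_enorm_inner_sq] using hS
  refine (ENNReal.summable_toReal this).congr fun i => ?_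
  simp

/-- The Hilbert–Schmidt inner product of two operators and that of their adjoints. -/
theorem tsum_inner_apply_adjoint {S T : H →L[ℂ] H} (hS : ∑' i, ‖S (basis H i)‖ₑ ^ 2 ≠ ⊤)
    (hT : ∑' i, ‖T (basis H i)‖ₑ ^ 2 ≠ ⊤) :
    ∑' i, inner ℂ (S (basis H i)) (T (basis H i)) =
      ∑' i, inner ℂ (T.adjoint (basis H i)) (S.adjoint (basis H i)) := by
  have e1 : ∀ i, inner ℂ (S (basis H i)) (T (basis H i)) =
      ∑' j, inner ℂ (S (basis H i)) (basis H j) * inner ℂ (basis H j) (T (basis H i)) :=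
    fun i => ((basis H).tsum_inner_mul_inner _ _).symm
  have e2 : ∀ j, inner ℂ (T.adjoint (basis H j)) (S.adjoint (basis H j)) =
      ∑' i, inner ℂ (S (basis H i)) (basis H j) * inner ℂ (basis H j) (T (basis H i)) := by
    intro j
    rw [← (basis H).tsum_inner_mul_inner]
    refine tsum_congr fun i => ?_
    rw [ContinuousLinearMap.adjoint_inner_left, ContinuousLinearMap.adjoint_inner_right, mul_comm]
  simp_rw [e1, e2]
  refine (Summable.tsum_comm (f := fun i j => inner ℂ (S (basis H i)) (basis H j) *
    inner ℂ (basis H j) (T (basis H i))) ?_).symm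
  -- The products are dominated by `a² + b²`, and both squared families are summable over pairs by
  -- the Hilbert–Schmidt hypotheses.
  refine Summable.of_norm_bounded ((norm_inner_apply_prod_summable hS).add
    (norm_inner_apply_prod_summable hT)) fun p => ?_
  simp only [Function.uncurry, norm_mul]
  rw [norm_inner_symm]
  nlinarith [sq_nonneg (‖(inner ℂ (basis H p.2) (S (basis H p.1)) : ℂ)‖ -
    ‖(inner ℂ (basis H p.2) (T (basis H p.1)) : ℂ)‖),
    norm_nonneg (inner ℂ (basis H p.2) (S (basis H p.1)) : ℂ),
    norm_nonneg (inner ℂ (basis H p.2) (T (basis H p.1)) : ℂ)]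

/-- The square root of a positive operator. -/
def sqrtOp (A : H →L[ℂ] H) : H →L[ℂ] H := CFC.sqrt A

theorem adjoint_sqrtOp (A : H →L[ℂ] H) : (sqrtOp A).adjoint = sqrtOp A :=
  (CFC.sqrt_nonneg A).isSelfAdjoint.adjoint_eq

theorem sqrtOp_zero : sqrtOp (0 : H →L[ℂ] H) = 0 := CFC.sqrt_zero

theorem sqrtOp_sqrtOp_apply {A : H →L[ℂ] H} (hA : A.IsPositive) (x : H) :
    sqrtOp A (sqrtOp A x) = A x := by
  have := CFC.sqrt_mul_sqrt_self A ((ContinuousLinearMap.nonneg_iff_isPositive A).mpr hA)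
  exact congrArg (fun T : H →L[ℂ] H => T x) this

theorem inner_sqrtOp_sqrtOp {A : H →L[ℂ] H} (hA : A.IsPositive) (x y : H) :
    inner ℂ (sqrtOp A x) (sqrtOp A y) = inner ℂ x (A y) := by
  rw [← ContinuousLinearMap.adjoint_inner_right, adjoint_sqrtOp, sqrtOp_sqrtOp_apply hA]

theorem norm_sqrtOp_apply_sq {A : H →L[ℂ] H} (hA : A.IsPositive) (x : H) :
    ‖sqrtOp A x‖ ^ 2 = (inner ℂ x (A x) : ℂ).re := by
  rw [← inner_sqrtOp_sqrtOp hA]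
  simpa using (inner_self_eq_norm_sq (𝕜 := ℂ) (sqrtOp A x)).symm

end AbstractTrace

/-! ### Mollification: smoothness, convergence, and compatibility with weak derivatives. -/

section Mollifier

open ContinuousLinearMap Convolution

set_option linter.unusedSectionVars false

variable {d : ℕ} {E : Type*} [NormedAddCommGroup E] [NormedSpace ℝ E]

/-- A sequence of bump functions shrinking to the origin. -/
def bump (d n : ℕ) : ContDiffBump (0 : Space d) where
  rIn := 1 / (n + 2)
  rOut := 2 / (n + 2)
  rIn_pos := by positivity
  rIn_lt_rOut := by gcongr; norm_num

/-- The normalized bump functions. -/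
def mollifier (d n : ℕ) : Space d → ℝ := (bump d n).normed volume

/-- The mollification `F * φ_n`. -/
def mollify (n : ℕ) (F : Space d → E) : Space d → E :=
  mollifier d n ⋆[lsmul ℝ ℝ, volume] F

theorem tendsto_bump_rOut (d : ℕ) : Tendsto (fun n => (bump d n).rOut) atTop (𝓝 0) := by
  have h : Tendsto (fun n : ℕ => (2 : ℝ) / ((n + 2 : ℕ) : ℝ)) atTop (𝓝 0) :=
    (tendsto_const_div_atTop_nhds_zero_nat 2).comp (tendsto_add_atTop_nat 2)
  refine h.congr fun n => ?_
  simp [bump]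

theorem mollify_apply (n : ℕ) (F : Space d → E) (x : Space d) :
    mollify n F x = ∫ y, mollifier d n (x - y) • F y :=
  convolution_lsmul_swap

theorem contDiff_mollifier (n : ℕ) : ContDiff ℝ ((⊤ : ℕ∞) : WithTop ℕ∞) (mollifier d n) :=
  (bump d n).contDiff_normed

theorem hasCompactSupport_mollifier (n : ℕ) : HasCompactSupport (mollifier d n) :=
  (bump d n).hasCompactSupport_normed

theorem tsupport_mollifier_sub (n : ℕ) (x : Space d) :
    tsupport (fun y => mollifier d n (x - y)) ⊆ Metric.closedBall x (bump d n).rOut := by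
  refine closure_minimal (fun y hy => ?_) Metric.isClosed_closedBall
  have h : x - y ∈ Function.support (mollifier d n) := hy
  rw [mollifier, ContDiffBump.support_normed_eq, mem_ball_zero_iff] at h
  rw [Metric.mem_closedBall, dist_comm, dist_eq_norm]
  exact h.le

theorem isTest_mollifier_sub (n : ℕ) (x : Space d) : IsTest fun y => mollifier d n (x - y) where
  contDiff := (contDiff_mollifier n).comp (contDiff_const.sub contDiff_id)
  hasCompactSupport := (isCompact_closedBall x _).of_isClosed_subset (isClosed_tsupport _)
    (tsupport_mollifier_sub n x)

theorem partialDeriv_mollifier_sub (n : ℕ) (j : Fin d) (x y : Space d) :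
    partialDeriv j (fun y => mollifier d n (x - y)) y = -partialDeriv j (mollifier d n) (x - y) := by
  have h1 : HasFDerivAt (mollifier d n) (fderiv ℝ (mollifier d n) (x - y)) (x - y) :=
    ((contDiff_mollifier n).differentiable (by simp) _).hasFDerivAt
  have h2 : HasFDerivAt (fun y : Space d => x - y) (-ContinuousLinearMap.id ℝ (Space d)) y := by
    simpa using (hasFDerivAt_id y).const_sub x
  have h3 := (h1.comp y h2).fderiv
  simp only [partialDeriv]
  rw [show (fun y => mollifier d n (x - y)) = mollifier d n ∘ fun y => x - y from rfl, h3]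
  simp

theorem contDiff_mollify (n : ℕ) {F : Space d → E} (hF : LocallyIntegrable F) :
    ContDiff ℝ ((⊤ : ℕ∞) : WithTop ℕ∞) (mollify n F) :=
  (hasCompactSupport_mollifier n).contDiff_convolution_left _ (contDiff_mollifier n) hF

theorem partialDeriv_mollify (n : ℕ) (j : Fin d) {F : Space d → E} (hF : LocallyIntegrable F)
    (x : Space d) :
    partialDeriv j (mollify n F) x = ∫ y, partialDeriv j (mollifier d n) (x - y) • F y := by
  have h := ((hasCompactSupport_mollifier n).hasFDerivAt_convolution_left
    (lsmul ℝ ℝ) ((contDiff_mollifier (d := d) n).of_le (by simp)) hF x).fderiv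
  have hi := (((hasCompactSupport_mollifier (d := d) n).fderiv ℝ).convolutionExists_left
    ((lsmul ℝ ℝ : ℝ →L[ℝ] E →L[ℝ] E).precompL (Space d))
    ((contDiff_mollifier n).continuous_fderiv (by simp)) hF x).integrable_swap
  rw [partialDeriv, mollify, h, convolution_eq_swap, ContinuousLinearMap.integral_apply hi]
  rfl

theorem ae_tendsto_mollify [CompleteSpace E] {F : Space d → E} (hF : LocallyIntegrable F) :
    ∀ᵐ x, Tendsto (fun n => mollify n F x) atTop (𝓝 (F x)) := by
  -- The outer radius is twice the inner one for every `n`; the constant `K = 2` records this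
  -- bounded ratio, under which Lebesgue differentiation applies.
  refine ContDiffBump.ae_convolution_tendsto_right_of_locallyIntegrable (K := 2)
    (tendsto_bump_rOut d) (Eventually.of_forall fun n => le_of_eq ?_) hF
  simp [bump]; ring

/-- Continuity of translations in `L¹`, read off from the continuity of composition with a
continuous family of measure-preserving maps. -/
theorem tendsto_lintegral_translate_sub {F : Space d → E} (hF : Integrable F) :
    Tendsto (fun t => ∫⁻ x, ‖F (x - t) - F x‖ₑ) (𝓝 0) (𝓝 0) := by
  have hmp : ∀ t : Space d, MeasurePreserving
      (⟨fun x => x - t, by fun_prop⟩ : C(Space d, Space d)) volume volume :=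
    fun t => measurePreserving_sub_right volume t
  have hc : Continuous fun t : Space d => (⟨fun x => x - t, by fun_prop⟩ : C(Space d, Space d)) :=
    (ContinuousMap.curry ⟨fun p : Space d × Space d => p.2 - p.1, by fun_prop⟩).continuous
  have h := (continuous_const (y := hF.toL1 F)).compMeasurePreservingLp hc hmp (by simp)
  have h2 := ((h.tendsto 0).edist (tendsto_const_nhds (x := hF.toL1 F)))
  have h0 : Lp.compMeasurePreserving _ (hmp 0) (hF.toL1 F) = hF.toL1 F := by
    refine Lp.ext ((Lp.coeFn_compMeasurePreserving _ (hmp 0)).trans ?_)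
    exact Eventually.of_forall fun x => by simp
  rw [h0, edist_self] at h2
  refine h2.congr fun t => ?_
  rw [Lp.edist_def, eLpNorm_one_eq_lintegral_enorm]
  refine lintegral_congr_ae ?_
  filter_upwards [Lp.coeFn_compMeasurePreserving (hF.toL1 F) (hmp t), hF.coeFn_toL1,
    (hmp t).quasiMeasurePreserving.ae_eq_comp hF.coeFn_toL1] with x h1 h2 h3
  simp only [Function.comp_apply, ContinuousMap.coe_mk, Pi.sub_apply] at *
  rw [h1, h2, h3]

theorem lintegral_enorm_mollifier (n : ℕ) : ∫⁻ t, ‖mollifier d n t‖ₑ = 1 := by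
  have h := (bump d n).integral_normed (μ := volume)
  rw [integral_eq_lintegral_of_nonneg_ae
    (Eventually.of_forall (bump d n).nonneg_normed)
    (bump d n).continuous_normed.aestronglyMeasurable] at h
  rw [← ENNReal.toReal_eq_one_iff, ← h]
  congr 1
  refine lintegral_congr fun t => ?_
  exact Real.enorm_eq_ofReal ((bump d n).nonneg_normed t)

/-- The mollifier has mass one, so `φₙ * F - F` is an average of the differences `F(· - t) - F`;
Tonelli exchanges the two integrals. -/
theorem lintegral_mollify_sub_le [CompleteSpace E] {F : Space d → E} (hF : Integrable F) (n : ℕ) :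
    ∫⁻ x, ‖mollify n F x - F x‖ₑ ≤
      ∫⁻ t, ‖mollifier d n t‖ₑ * ∫⁻ x, ‖F (x - t) - F x‖ₑ := by
  have hm : AEStronglyMeasurable (fun p : Space d × Space d => F (p.2 - p.1) - F p.2)
      (volume.prod volume) := by
    refine AEStronglyMeasurable.sub ?_ hF.aestronglyMeasurable.comp_snd
    exact hF.aestronglyMeasurable.comp_quasiMeasurePreserving
      ((quasiMeasurePreserving_sub volume volume).comp
        Measure.measurePreserving_swap.quasiMeasurePreserving)
  have hm2 : AEMeasurable (fun p : Space d × Space d => ‖mollifier d n p.1‖ₑ *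
      ‖F (p.2 - p.1) - F p.2‖ₑ) (volume.prod volume) :=
    (((bump d n).continuous_normed.comp continuous_fst).measurable.enorm.aemeasurable).mul hm.enorm
  calc ∫⁻ x, ‖mollify n F x - F x‖ₑ
      ≤ ∫⁻ x, ∫⁻ t, ‖mollifier d n t‖ₑ * ‖F (x - t) - F x‖ₑ := by
        refine lintegral_mono fun x => ?_
        have e : mollify n F x - F x = ∫ t, mollifier d n t • (F (x - t) - F x) := by
          have h1 : Integrable fun t => mollifier d n t • F (x - t) :=
            ((hasCompactSupport_mollifier (d := d) n).convolutionExists_left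
              (lsmul ℝ ℝ : ℝ →L[ℝ] E →L[ℝ] E)
              (contDiff_mollifier n).continuous hF.locallyIntegrable x).integrable
          have h2 : Integrable fun t => mollifier d n t • F x :=
            ((bump d n).integrable_normed).smul_const _
          simp only [smul_sub]
          rw [integral_sub h1 h2]
          congr 1
          exact ((bump d n).integral_normed_smul volume (F x)).symm
        rw [e]
        refine (enorm_integral_le_lintegral_enorm _).trans (le_of_eq ?_)
        simp [enorm_smul]
    _ = ∫⁻ t, ∫⁻ x, ‖mollifier d n t‖ₑ * ‖F (x - t) - F x‖ₑ :=
        lintegral_lintegral_swap hm2.prod_swap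
    _ = _ := by
        refine lintegral_congr fun t => ?_
        rw [lintegral_const_mul' _ _ (by simp)]

theorem tendsto_lintegral_mollify_sub_of_integrable [CompleteSpace E] {F : Space d → E}
    (hF : Integrable F) :
    Tendsto (fun n => ∫⁻ x, ‖mollify n F x - F x‖ₑ) atTop (𝓝 0) := by
  rw [ENNReal.tendsto_nhds_zero]
  intro ε hε
  have h := ENNReal.tendsto_nhds_zero.mp (tendsto_lintegral_translate_sub hF) ε hε
  obtain ⟨r, hr, hr'⟩ := Metric.eventually_nhds_iff_ball.mp h
  filter_upwards [(tendsto_bump_rOut d).eventually_lt_const hr] with n hn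
  refine (lintegral_mollify_sub_le hF n).trans ?_
  calc _ ≤ ∫⁻ t, ‖mollifier d n t‖ₑ * ε := by
        refine lintegral_mono fun t => ?_
        by_cases ht : t ∈ Metric.ball 0 (bump d n).rOut
        · exact mul_le_mul_right (hr' t (Metric.ball_subset_ball hn.le ht)) _
        · have : mollifier d n t = 0 := by
            rw [← (bump d n).support_normed_eq (μ := volume)] at ht
            exact Function.notMem_support.mp ht
          simp [this]
    _ = ε := by
        rw [lintegral_mul_const _ (contDiff_mollifier n).continuous.measurable.enorm,
          lintegral_enorm_mollifier, one_mul]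

/-- Locality of mollification: it allows a locally integrable function to be cut off outside a
neighbourhood of a compact set. -/
theorem mollify_congr {F G : Space d → E} {n : ℕ} {x : Space d}
    (h : ∀ y ∈ Metric.closedBall x (bump d n).rOut, F y = G y) : mollify n F x = mollify n G x := by
  rw [mollify_apply, mollify_apply]
  refine integral_congr_ae (Eventually.of_forall fun y => ?_)
  by_cases hy : y ∈ Metric.closedBall x (bump d n).rOut
  · simp only [h y hy]
  · have : mollifier d n (x - y) = 0 := by
      by_contra h0
      exact hy (tsupport_mollifier_sub n x (subset_tsupport _ h0))
    simp only [this, zero_smul]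

/-- Mollifications converge in `L¹_loc`. -/
theorem tendsto_lintegral_mollify_sub [CompleteSpace E] {F : Space d → E}
    (hF : LocallyIntegrable F) {K : Set (Space d)} (hK : IsCompact K) :
    Tendsto (fun n => ∫⁻ x in K, ‖mollify n F x - F x‖ₑ) atTop (𝓝 0) := by
  have hK1 := hK.cthickening (r := 1)
  have hF1 : Integrable ((Metric.cthickening 1 K).indicator F) :=
    (hF.integrableOn_isCompact hK1).integrable_indicator hK1.measurableSet
  refine tendsto_of_tendsto_of_tendsto_of_le_of_le' tendsto_const_nhds
    (tendsto_lintegral_mollify_sub_of_integrable hF1) (Eventually.of_forall fun n => zero_le) ?_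
  filter_upwards [(tendsto_bump_rOut d).eventually_lt_const one_pos] with n hn
  refine le_trans (le_of_eq ?_) (setLIntegral_le_lintegral K _)
  refine setLIntegral_congr_fun hK.measurableSet fun x hx => ?_
  have h1 : Metric.closedBall x (bump d n).rOut ⊆ Metric.cthickening 1 K :=
    (Metric.closedBall_subset_closedBall hn.le).trans
      (Metric.closedBall_subset_cthickening hx 1)
  have h2 : mollify n F x = mollify n ((Metric.cthickening 1 K).indicator F) x :=
    mollify_congr fun y hy => (Set.indicator_of_mem (h1 hy) F).symm
  have h3 : (Metric.cthickening 1 K).indicator F x = F x :=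
    Set.indicator_of_mem (Metric.self_subset_cthickening K hx) F
  simp only [h2, h3]

/-- `G = ∂_j F` in the sense of distributions on the open set `O`. -/
def HasWeakPartialOn (O : Set (Space d)) (j : Fin d) (F G : Space d → E) : Prop :=
  ∀ η : Space d → ℝ, IsTest η → tsupport η ⊆ O →
    ∫ x, partialDeriv j η x • F x = -∫ x, η x • G x

/-- Once the ball lies in `O`, the kernel `y ↦ φₙ(x - y)` is an admissible test function. The sign
from differentiating in `y` cancels the sign in the definition of the weak derivative. -/
theorem HasWeakPartialOn.partialDeriv_mollify {O : Set (Space d)} {j : Fin d} {F G : Space d → E}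
    (h : HasWeakPartialOn O j F G) (hF : LocallyIntegrable F) {n : ℕ} {x : Space d}
    (hx : Metric.closedBall x (bump d n).rOut ⊆ O) :
    partialDeriv j (mollify n F) x = mollify n G x := by
  rw [ErgodicHO.partialDeriv_mollify n j hF, mollify_apply]
  have := h _ (isTest_mollifier_sub n x) ((tsupport_mollifier_sub n x).trans hx)
  simp only [partialDeriv_mollifier_sub, neg_smul, integral_neg, neg_inj] at this
  exact this

end Mollifier

/-! ### Elementary properties of test functions. -/

section TestFunctions

variable {d : ℕ} {F : Type*} [NormedAddCommGroup F] [NormedSpace ℝ F]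

theorem IsTest.continuous {η : Space d → F} (hη : IsTest η) : Continuous η :=
  hη.contDiff.continuous

theorem IsTest.continuous_partialDeriv {η : Space d → F} (hη : IsTest η) (j : Fin d) :
    Continuous (partialDeriv j η) :=
  (hη.contDiff.continuous_fderiv (by simp)).clm_apply continuous_const

theorem tsupport_partialDeriv_subset (j : Fin d) (η : Space d → F) :
    tsupport (partialDeriv j η) ⊆ tsupport η := by
  refine closure_minimal (fun x hx => ?_) (isClosed_tsupport _)
  refine support_fderiv_subset ℝ (f := η) fun h => hx ?_
  simp [partialDeriv, h]

theorem IsTest.hasCompactSupport_partialDeriv {η : Space d → F} (hη : IsTest η) (j : Fin d) :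
    HasCompactSupport (partialDeriv j η) :=
  hη.hasCompactSupport.of_isClosed_subset (isClosed_tsupport _) (tsupport_partialDeriv_subset j η)

theorem IsTest.differentiableAt {η : Space d → F} (hη : IsTest η) (x : Space d) :
    DifferentiableAt ℝ η x :=
  hη.contDiff.differentiable (by simp) x

end TestFunctions

/-! ### Weak chain rule for the regularized norm `√(ε + ‖F‖²)`. -/

section ChainRule

set_option linter.unusedSectionVars false

variable {d : ℕ} {E : Type*} [NormedAddCommGroup E] [InnerProductSpace ℝ E] [CompleteSpace E]

/-- Multiplying the difference of the roots by their sum gives `‖v‖² - ‖w‖²`, and that sum is at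
least `‖v‖ + ‖w‖`. -/
theorem abs_sqrt_add_norm_sq_sub_le {ε : ℝ} (hε : 0 < ε) (v w : E) :
    |√(ε + ‖v‖ ^ 2) - √(ε + ‖w‖ ^ 2)| ≤ ‖v - w‖ := by
  have h1 : 0 < ε + ‖v‖ ^ 2 := by positivity
  have h2 : 0 < ε + ‖w‖ ^ 2 := by positivity
  have hs1 := Real.sqrt_pos.mpr h1
  have hs2 := Real.sqrt_pos.mpr h2
  have e1 := Real.sq_sqrt h1.le
  have e2 := Real.sq_sqrt h2.le
  have hv : ‖v‖ ≤ √(ε + ‖v‖ ^ 2) := Real.le_sqrt_of_sq_le (by linarith)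
  have hw : ‖w‖ ≤ √(ε + ‖w‖ ^ 2) := Real.le_sqrt_of_sq_le (by linarith)
  have key : (√(ε + ‖v‖ ^ 2) - √(ε + ‖w‖ ^ 2)) * (√(ε + ‖v‖ ^ 2) + √(ε + ‖w‖ ^ 2)) =
      (‖v‖ - ‖w‖) * (‖v‖ + ‖w‖) := by ring_nf; rw [e1, e2]; ring
  have habs := congrArg abs key
  rw [abs_mul, abs_mul, abs_of_pos (add_pos hs1 hs2),
    abs_of_nonneg (add_nonneg (norm_nonneg v) (norm_nonneg w))] at habs
  refine le_trans ?_ (abs_norm_sub_norm_le v w)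
  by_contra! hlt
  have h0 : 0 ≤ |‖v‖ - ‖w‖| := abs_nonneg _
  nlinarith [norm_nonneg v, norm_nonneg w]

/-- This use of Cauchy–Schwarz is the pointwise core of the Hoffmann-Ostenhof inequality: the bound
depends neither on `ε` nor on the dimension of `E`. -/
theorem abs_inner_div_sqrt_le {ε : ℝ} (hε : 0 < ε) (v w : E) :
    |inner ℝ v w / √(ε + ‖v‖ ^ 2)| ≤ ‖w‖ := by
  have h1 : 0 < ε + ‖v‖ ^ 2 := by positivity
  have hv : ‖v‖ ≤ √(ε + ‖v‖ ^ 2) := Real.le_sqrt_of_sq_le (by linarith)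
  rw [abs_div, abs_of_pos (Real.sqrt_pos.mpr h1), div_le_iff₀ (Real.sqrt_pos.mpr h1)]
  calc _ ≤ ‖v‖ * ‖w‖ := abs_real_inner_le_norm v w
    _ ≤ _ := by rw [mul_comm]; gcongr

theorem partialDeriv_sqrt_add_norm_sq {ε : ℝ} (hε : 0 < ε) {F : Space d → E} {x : Space d}
    (hF : DifferentiableAt ℝ F x) (j : Fin d) :
    partialDeriv j (fun y => √(ε + ‖F y‖ ^ 2)) x =
      inner ℝ (F x) (partialDeriv j F x) / √(ε + ‖F x‖ ^ 2) := by
  have h1 : 0 < ε + ‖F x‖ ^ 2 := by positivity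
  have h := ((hF.hasFDerivAt.norm_sq.const_add ε).sqrt h1.ne').fderiv
  rw [partialDeriv, h, partialDeriv]
  simp
  field_simp

/-- The identity is classical for the mollifications of `F`, whose derivatives near the support of
the test function are the mollifications of `G`. Both sides then pass to the limit, because the
regularized norm is `1`-Lipschitz and the coefficient of `G` is bounded by `1`. -/
theorem HasWeakPartialOn.sqrt_add_norm_sq {O : Set (Space d)} (hO : IsOpen O) {j : Fin d}
    {F G : Space d → E} (h : HasWeakPartialOn O j F G) (hF : LocallyIntegrable F)
    (hG : LocallyIntegrable G) {ε : ℝ} (hε : 0 < ε) :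
    HasWeakPartialOn O j (fun x => √(ε + ‖F x‖ ^ 2))
      (fun x => inner ℝ (F x) (G x) / √(ε + ‖F x‖ ^ 2)) := by
  intro η hη hηO
  set K := tsupport η with hKdef
  have hK : IsCompact K := hη.hasCompactSupport
  have hpos : ∀ v : E, 0 < √(ε + ‖v‖ ^ 2) := fun v => Real.sqrt_pos.mpr (by positivity)
  have hcont : Continuous fun v : E => √(ε + ‖v‖ ^ 2) := by fun_prop
  have hFm := hF.aestronglyMeasurable
  have hGm := hG.aestronglyMeasurable
  have hFn : LocallyIntegrable fun x => ‖F x‖ := hF.mono hFm.norm (by simp)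
  have hGn : LocallyIntegrable fun x => ‖G x‖ := hG.mono hGm.norm (by simp)
  have hcF : ∀ n, Continuous (mollify n F) := fun n => (contDiff_mollify n hF).continuous
  have hcG : ∀ n, Continuous (mollify n G) := fun n => (contDiff_mollify n hG).continuous
  have hvF : LocallyIntegrable fun x => √(ε + ‖F x‖ ^ 2) := by
    refine LocallyIntegrable.mono ((locallyIntegrable_const (√ε)).add hFn)
      (hcont.comp_aestronglyMeasurable hFm) (Eventually.of_forall fun x => ?_)
    have := abs_sqrt_add_norm_sq_sub_le hε (F x) 0
    simp only [norm_zero, sub_zero] at this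
    have h2 := abs_le.mp this
    simp only [ne_eq, OfNat.ofNat_ne_zero, not_false_eq_true, zero_pow, add_zero] at h2
    rw [Real.norm_of_nonneg (Real.sqrt_nonneg _), Pi.add_apply,
      Real.norm_of_nonneg (by positivity)]
    linarith [h2.2]
  have hηint : ∀ u : Space d → ℝ, LocallyIntegrable u → Integrable fun x => η x • u x :=
    fun u hu => hu.integrable_smul_left_of_hasCompactSupport hη.continuous hη.hasCompactSupport
  have hη'int : ∀ u : Space d → ℝ, LocallyIntegrable u →
      Integrable fun x => partialDeriv j η x • u x :=
    fun u hu => hu.integrable_smul_left_of_hasCompactSupport (hη.continuous_partialDeriv j)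
      (hη.hasCompactSupport_partialDeriv j)
  have hdiff : ∀ n, Differentiable ℝ fun x => √(ε + ‖mollify n F x‖ ^ 2) := fun n =>
    (((contDiff_mollify n hF).differentiable (by simp)).norm_sq ℝ |>.const_add ε).sqrt
      fun x => by positivity
  have hcv : ∀ n, Continuous fun x => √(ε + ‖mollify n F x‖ ^ 2) := fun n => hcont.comp (hcF n)
  have hparts : ∀ᶠ n in atTop, ∫ x, partialDeriv j η x • √(ε + ‖mollify n F x‖ ^ 2) =
      -∫ x, η x • (inner ℝ (mollify n F x) (mollify n G x) / √(ε + ‖mollify n F x‖ ^ 2)) := by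
    -- For mollification radii below `δ`, every ball centred in the support of `η` stays inside `O`,
    -- where the weak derivative is known.
    obtain ⟨δ, hδ, hδO⟩ := hK.exists_cthickening_subset_open hO hηO
    filter_upwards [(tendsto_bump_rOut d).eventually_lt_const hδ] with n hn
    have hpd : ∀ x, η x • partialDeriv j (fun x => √(ε + ‖mollify n F x‖ ^ 2)) x =
        η x • (inner ℝ (mollify n F x) (mollify n G x) / √(ε + ‖mollify n F x‖ ^ 2)) := by
      intro x
      by_cases hx : x ∈ K
      · rw [partialDeriv_sqrt_add_norm_sq hε ((contDiff_mollify n hF).differentiable (by simp) x),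
          h.partialDeriv_mollify hF]
        exact ((Metric.closedBall_subset_closedBall hn.le).trans
          (Metric.closedBall_subset_cthickening hx δ)).trans hδO
      · rw [image_eq_zero_of_notMem_tsupport hx, zero_smul, zero_smul]
    have hcq : Continuous fun x =>
        inner ℝ (mollify n F x) (mollify n G x) / √(ε + ‖mollify n F x‖ ^ 2) :=
      ((hcF n).inner (hcG n)).div (hcv n) fun x => (hpos _).ne'
    have key := integral_mul_fderiv_eq_neg_fderiv_mul_of_integrable (μ := volume)
      (f := fun x => √(ε + ‖mollify n F x‖ ^ 2)) (g := η) (v := EuclideanSpace.single j (1 : ℝ))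
      ?_ ?_ ?_ (fun x _ => hdiff n x) (fun x _ => hη.differentiableAt x)
    · simp only [← hpd]
      simp only [smul_eq_mul, mul_comm (η _), mul_comm (partialDeriv j η _)]
      exact key
    · refine (hηint _ hcq.locallyIntegrable).congr (Eventually.of_forall fun x => ?_)
      simp only [← hpd, smul_eq_mul]
      rw [mul_comm]; rfl
    · refine (hη'int _ (hcv n).locallyIntegrable).congr (Eventually.of_forall fun x => ?_)
      simp only [smul_eq_mul]
      rw [mul_comm]; rfl
    · refine (hηint _ (hcv n).locallyIntegrable).congr (Eventually.of_forall fun x => ?_)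
      simp only [smul_eq_mul]
      rw [mul_comm]
  -- Convergence criterion used twice: a sequence dominated pointwise by the mollification error of
  -- `V` tends to zero in `L¹` after multiplication by a continuous function supported in `K`.
  have hbd : ∀ ζ : Space d → ℝ, Continuous ζ → HasCompactSupport ζ → tsupport ζ ⊆ K →
      ∀ (V : Space d → E), LocallyIntegrable V → ∀ u : ℕ → Space d → ℝ,
      (∀ n x, |u n x| ≤ ‖mollify n V x - V x‖) →
      Tendsto (fun n => ∫⁻ x, ‖ζ x • u n x‖ₑ) atTop (𝓝 0) := by
    intro ζ hζ hζc hζK V hV u hu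
    obtain ⟨C, hC⟩ := hζc.exists_bound_of_continuous hζ
    have hlim : Tendsto (fun n => ENNReal.ofReal C * ∫⁻ x in K, ‖mollify n V x - V x‖ₑ) atTop
        (𝓝 0) := by
      simpa using ENNReal.Tendsto.const_mul (a := ENNReal.ofReal C)
        (tendsto_lintegral_mollify_sub hV hK) (Or.inr (by simp))
    refine tendsto_of_tendsto_of_tendsto_of_le_of_le tendsto_const_nhds hlim (fun n => zero_le)
      fun n => ?_
    rw [← lintegral_const_mul' _ _ (by simp), ← lintegral_indicator hK.measurableSet]
    refine lintegral_mono fun x => ?_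
    by_cases hx : x ∈ K
    · rw [indicator_of_mem hx, enorm_smul]
      gcongr
      · rw [← ofReal_norm]; exact ENNReal.ofReal_le_ofReal (hC x)
      · rw [enorm_le_iff_norm_le]; exact hu n x
    · rw [image_eq_zero_of_notMem_tsupport fun h => hx (hζK h)]
      simp
  have hL : Tendsto (fun n => ∫ x, partialDeriv j η x • √(ε + ‖mollify n F x‖ ^ 2)) atTop
      (𝓝 (∫ x, partialDeriv j η x • √(ε + ‖F x‖ ^ 2))) := by
    refine tendsto_integral_of_L1 _ (hη'int _ hvF).aestronglyMeasurable
      (Eventually.of_forall fun n => hη'int _ (hcv n).locallyIntegrable) ?_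
    simp only [← smul_sub]
    exact hbd _ (hη.continuous_partialDeriv j) (hη.hasCompactSupport_partialDeriv j)
      (tsupport_partialDeriv_subset j η) F hF _ fun n x => abs_sqrt_add_norm_sq_sub_le hε _ _
  have hmW : ∀ n, AEStronglyMeasurable (fun x => inner ℝ (mollify n F x) (G x) /
      √(ε + ‖mollify n F x‖ ^ 2)) volume := fun n =>
    (((hcF n).aestronglyMeasurable.inner hGm).aemeasurable.div
      (hcv n).aemeasurable).aestronglyMeasurable
  have hlW : ∀ n, LocallyIntegrable fun x => inner ℝ (mollify n F x) (G x) /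
      √(ε + ‖mollify n F x‖ ^ 2) := fun n =>
    hG.mono (hmW n) (Eventually.of_forall fun x => abs_inner_div_sqrt_le hε _ _)
  -- The right side is split as `⟨Fₙ, Gₙ⟩ = ⟨Fₙ, G⟩ + ⟨Fₙ, Gₙ - G⟩`. The first term converges by
  -- dominated convergence with majorant `|η| ‖G‖`; the second tends to zero because `Gₙ → G` in
  -- `L¹` on `K`.
  have hR1 : Tendsto (fun n => ∫ x, η x • (inner ℝ (mollify n F x) (G x) /
      √(ε + ‖mollify n F x‖ ^ 2))) atTop
      (𝓝 (∫ x, η x • (inner ℝ (F x) (G x) / √(ε + ‖F x‖ ^ 2)))) := by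
    refine tendsto_integral_of_dominated_convergence (fun x => ‖η x • ‖G x‖‖)
      (fun n => (hηint _ (hlW n)).aestronglyMeasurable) (hηint _ hGn).norm
      (fun n => Eventually.of_forall fun x => ?_) ?_
    · rw [norm_smul, norm_smul, norm_norm]
      gcongr
      exact abs_inner_div_sqrt_le hε _ _
    · filter_upwards [ae_tendsto_mollify hF] with x hx
      exact ((hx.inner tendsto_const_nhds).div ((hcont.tendsto _).comp hx)
        (hpos _).ne').const_smul _
  have hR2 : Tendsto (fun n => ∫ x, η x • (inner ℝ (mollify n F x) (mollify n G x - G x) /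
      √(ε + ‖mollify n F x‖ ^ 2))) atTop (𝓝 0) := by
    have := hbd η hη.continuous hη.hasCompactSupport le_rfl G hG
      (fun n x => inner ℝ (mollify n F x) (mollify n G x - G x) / √(ε + ‖mollify n F x‖ ^ 2))
      (fun n x => abs_inner_div_sqrt_le hε _ _)
    rw [tendsto_zero_iff_enorm_tendsto_zero]
    exact tendsto_of_tendsto_of_tendsto_of_le_of_le tendsto_const_nhds this (fun n => zero_le)
      fun n => enorm_integral_le_lintegral_enorm _
  have hR : Tendsto (fun n => ∫ x, η x • (inner ℝ (mollify n F x) (mollify n G x) /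
      √(ε + ‖mollify n F x‖ ^ 2))) atTop
      (𝓝 (∫ x, η x • (inner ℝ (F x) (G x) / √(ε + ‖F x‖ ^ 2)))) := by
    have := hR2.add hR1
    rw [zero_add] at this
    refine this.congr fun n => ?_
    have hcq : Continuous fun x =>
        inner ℝ (mollify n F x) (mollify n G x) / √(ε + ‖mollify n F x‖ ^ 2) :=
      ((hcF n).inner (hcG n)).div (hcv n) fun x => (hpos _).ne'
    have e : ∀ x, η x • (inner ℝ (mollify n F x) (mollify n G x - G x) /
        √(ε + ‖mollify n F x‖ ^ 2)) = η x • (inner ℝ (mollify n F x) (mollify n G x) /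
        √(ε + ‖mollify n F x‖ ^ 2)) - η x • (inner ℝ (mollify n F x) (G x) /
        √(ε + ‖mollify n F x‖ ^ 2)) := fun x => by
      rw [inner_sub_right, sub_div, smul_sub]
    simp only [e]
    rw [integral_sub (hηint _ hcq.locallyIntegrable) (hηint _ (hlW n)), sub_add_cancel]
  exact tendsto_nhds_unique (hL.congr' hparts) hR.neg

end ChainRule

/-! ### Weak derivative of `√(∑ |fₙ|²)` for countably many functions. -/

section SqrtOfSum

variable {d : ℕ}

theorem norm_toLp_sq {𝕜 : Type*} [RCLike 𝕜] {σ : Type*} [Fintype σ] (v : σ → 𝕜) :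
    ‖(WithLp.toLp 2 v : EuclideanSpace 𝕜 σ)‖ ^ 2 = ∑ i, ‖v i‖ ^ 2 := by
  rw [EuclideanSpace.norm_sq_eq]

theorem norm_toLp_le_sum {𝕜 : Type*} [RCLike 𝕜] {σ : Type*} [Fintype σ] (v : σ → 𝕜) :
    ‖(WithLp.toLp 2 v : EuclideanSpace 𝕜 σ)‖ ≤ ∑ i, ‖v i‖ := by
  refine le_of_sq_le_sq ?_ (by positivity)
  rw [norm_toLp_sq]
  exact Finset.sum_sq_le_sq_sum_of_nonneg fun i _ => norm_nonneg _

theorem real_inner_toLp {σ : Type*} [Fintype σ] (v w : σ → ℂ) :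
    inner ℝ (WithLp.toLp 2 v : EuclideanSpace ℂ σ) (WithLp.toLp 2 w) = ∑ i, inner ℝ (v i) (w i) := by
  rw [PiLp.inner_apply]

theorem locallyIntegrable_toLp {𝕜 : Type*} [RCLike 𝕜] {σ : Type*} [Fintype σ] {f : σ → Space d → 𝕜}
    (hf : ∀ i, LocallyIntegrable (f i)) :
    LocallyIntegrable fun x => (WithLp.toLp 2 fun i => f i x : EuclideanSpace 𝕜 σ) := by
  have hs : LocallyIntegrable fun x => ∑ i, ‖f i x‖ :=
    locallyIntegrable_finsetSum _ fun i _ => (hf i).mono (hf i).aestronglyMeasurable.norm (by simp)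
  refine hs.mono ?_ (Eventually.of_forall fun x => ?_)
  · exact (PiLp.continuous_toLp 2 fun _ : σ => 𝕜).comp_aestronglyMeasurable
      (aemeasurable_pi_iff.mpr fun i =>
        (hf i).aestronglyMeasurable.aemeasurable).aestronglyMeasurable
  · exact (norm_toLp_le_sum _).trans (le_abs_self _)

theorem HasWeakPartialOn.toLp {σ : Type*} [Fintype σ] {O : Set (Space d)} {j : Fin d}
    {f h : σ → Space d → ℂ} (hf : ∀ i, LocallyIntegrable (f i)) (hh : ∀ i, LocallyIntegrable (h i))
    (H : ∀ i, HasWeakPartialOn O j (f i) (h i)) :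
    HasWeakPartialOn O j (fun x => (WithLp.toLp 2 fun i => f i x : EuclideanSpace ℂ σ))
      (fun x => WithLp.toLp 2 fun i => h i x) := by
  intro η hη hηO
  have h1 := (locallyIntegrable_toLp hf).integrable_smul_left_of_hasCompactSupport
    (hη.continuous_partialDeriv j) (hη.hasCompactSupport_partialDeriv j)
  have h2 := (locallyIntegrable_toLp hh).integrable_smul_left_of_hasCompactSupport
    hη.continuous hη.hasCompactSupport
  ext i
  have e1 := ContinuousLinearMap.integral_comp_comm
    (PiLp.proj (𝕜 := ℝ) 2 (fun _ : σ => ℂ) i) h1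
  have e2 := ContinuousLinearMap.integral_comp_comm
    (PiLp.proj (𝕜 := ℝ) 2 (fun _ : σ => ℂ) i) h2
  simp only [PiLp.proj_apply, PiLp.smul_apply, PiLp.neg_apply] at e1 e2 ⊢
  rw [← e1, ← e2]
  exact H i η hη hηO

variable {ι : Type*}

/-- The `j`-th weak derivative of `√(∑ |f_n|²)`, in terms of weak derivatives `h_n` of `f_n`. -/
def sqrtSumPartial (f h : ι → Space d → ℂ) (x : Space d) : ℝ :=
  (∑' n, inner ℝ (f n x) (h n x)) / √(∑' n, ‖f n x‖ ^ 2)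

/-- The product filter lets the finite index set grow and `ε` decrease to zero independently, so a
single limit removes both regularizations. -/
theorem tendsto_inner_div_sqrt {v w : ι → ℂ} (hv : Summable fun n => ‖v n‖ ^ 2)
    (hw : Summable fun n => ‖w n‖ ^ 2) :
    Tendsto (fun p : Finset ι × ℝ => (∑ n ∈ p.1, inner ℝ (v n) (w n)) /
      √(p.2 + ∑ n ∈ p.1, ‖v n‖ ^ 2)) (atTop ×ˢ 𝓝[>] 0)
      (𝓝 ((∑' n, inner ℝ (v n) (w n)) / √(∑' n, ‖v n‖ ^ 2))) := by
  have hi : Summable fun n => inner ℝ (v n) (w n) := by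
    refine Summable.of_norm_bounded (hv.add hw) fun n => ?_
    have := abs_real_inner_le_norm (v n) (w n)
    rw [Real.norm_eq_abs]
    nlinarith [sq_nonneg (‖v n‖ - ‖w n‖), norm_nonneg (v n), norm_nonneg (w n)]
  -- If all `v n` vanish, the quotient is `0` before and after the limit. Division by zero thus
  -- gives the value `0` for the derivative of the root where the sum vanishes.
  by_cases h0 : ∑' n, ‖v n‖ ^ 2 = 0
  · have hv0 : ∀ n, v n = 0 := fun n => by
      have := (hasSum_zero_iff_of_nonneg fun n => sq_nonneg ‖v n‖).mp (h0 ▸ hv.hasSum)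
      simpa using congrFun this n
    simp [hv0]
  · have hε : Tendsto (fun p : Finset ι × ℝ => p.2) (atTop ×ˢ 𝓝[>] 0) (𝓝 0) :=
      (tendsto_snd.mono_right nhdsWithin_le_nhds)
    refine Tendsto.div (hi.hasSum.comp tendsto_fst) ?_ ?_
    · simpa using (hε.add (hv.hasSum.comp tendsto_fst)).sqrt
    · exact (Real.sqrt_pos.mpr (lt_of_le_of_ne (tsum_nonneg fun n => sq_nonneg _)
        (Ne.symm h0))).ne'

/-- A majorant independent of both `s` and `ε`: it dominates the approximations and survives in the
limit as the pointwise inequality. -/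
theorem abs_inner_div_sqrt_le_sqrt_tsum {v w : ι → ℂ} (hw : Summable fun n => ‖w n‖ ^ 2)
    (s : Finset ι) {ε : ℝ} (hε : 0 < ε) :
    |(∑ n ∈ s, inner ℝ (v n) (w n)) / √(ε + ∑ n ∈ s, ‖v n‖ ^ 2)| ≤ √(∑' n, ‖w n‖ ^ 2) := by
  have h := abs_inner_div_sqrt_le hε (WithLp.toLp 2 fun n : s => v n : EuclideanSpace ℂ s)
    (WithLp.toLp 2 fun n : s => w n)
  rw [real_inner_toLp, norm_toLp_sq, Finset.sum_coe_sort s fun n => inner ℝ (v n) (w n),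
    Finset.sum_coe_sort s fun n => ‖v n‖ ^ 2] at h
  refine h.trans (Real.le_sqrt_of_sq_le ?_)
  rw [norm_toLp_sq, Finset.sum_coe_sort s fun n => ‖w n‖ ^ 2]
  exact hw.sum_le_tsum s fun n _ => sq_nonneg _

theorem abs_sqrtSumPartial_le {f h : ι → Space d → ℂ} {x : Space d}
    (hf : Summable fun n => ‖f n x‖ ^ 2) (hh : Summable fun n => ‖h n x‖ ^ 2) :
    |sqrtSumPartial f h x| ≤ √(∑' n, ‖h n x‖ ^ 2) := by
  refine le_of_tendsto (tendsto_inner_div_sqrt hf hh).abs ?_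
  have : ∀ᶠ p : Finset ι × ℝ in atTop ×ˢ 𝓝[>] 0, 0 < p.2 :=
    tendsto_snd.eventually self_mem_nhdsWithin
  filter_upwards [this] with p hp
  exact abs_inner_div_sqrt_le_sqrt_tsum hh p.1 hp

/-- If `h_n = ∂_j f_n` weakly on `O`, then `√(∑ |f_n|²)` is weakly differentiable on `O`. -/
theorem hasWeakPartialOn_sqrt_tsum [Countable ι] {O : Set (Space d)} (hO : IsOpen O) {j : Fin d}
    {f h : ι → Space d → ℂ} (hf : ∀ n, LocallyIntegrable (f n)) (hh : ∀ n, LocallyIntegrable (h n))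
    (H : ∀ n, HasWeakPartialOn O j (f n) (h n))
    (hfs : ∀ᵐ x, Summable fun n => ‖f n x‖ ^ 2) (hhs : ∀ᵐ x, Summable fun n => ‖h n x‖ ^ 2)
    (hfi : LocallyIntegrable fun x => √(∑' n, ‖f n x‖ ^ 2))
    (hhi : LocallyIntegrable fun x => √(∑' n, ‖h n x‖ ^ 2)) :
    HasWeakPartialOn O j (fun x => √(∑' n, ‖f n x‖ ^ 2)) (sqrtSumPartial f h) := by
  intro η hη hηO
  -- For finite `s`, the family is one function with values in `EuclideanSpace ℂ s`, to which the
  -- regularized chain rule applies.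
  have hfin : ∀ (s : Finset ι) (ε : ℝ), 0 < ε →
      ∫ x, partialDeriv j η x • √(ε + ∑ n ∈ s, ‖f n x‖ ^ 2) =
        -∫ x, η x • ((∑ n ∈ s, inner ℝ (f n x) (h n x)) / √(ε + ∑ n ∈ s, ‖f n x‖ ^ 2)) := by
    intro s ε hε
    have h1 := (HasWeakPartialOn.toLp (fun n : s => hf n) (fun n : s => hh n)
      fun n : s => H n).sqrt_add_norm_sq hO (locallyIntegrable_toLp fun n : s => hf n)
      (locallyIntegrable_toLp fun n : s => hh n) hε η hη hηO
    simp only [real_inner_toLp, norm_toLp_sq] at h1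
    convert! h1 using 6 with x x
    · exact (Finset.sum_coe_sort s fun n => ‖f n x‖ ^ 2).symm
    · exact (Finset.sum_coe_sort s fun n => inner ℝ (f n x) (h n x)).symm
    · exact congrArg (fun t => √(ε + t)) (Finset.sum_coe_sort s fun n => ‖f n x‖ ^ 2).symm
  have hpos : ∀ᶠ p : Finset ι × ℝ in atTop ×ˢ 𝓝[>] 0, 0 < p.2 :=
    tendsto_snd.eventually self_mem_nhdsWithin
  have hlt : ∀ᶠ p : Finset ι × ℝ in atTop ×ˢ 𝓝[>] 0, p.2 < 1 :=
    tendsto_snd.eventually (mem_nhdsWithin_of_mem_nhds (Iio_mem_nhds one_pos))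
  have hfm : ∀ n, AEMeasurable (f n) := fun n => (hf n).aestronglyMeasurable.aemeasurable
  have hm1 : ∀ (s : Finset ι) (ε : ℝ), AEMeasurable fun x => √(ε + ∑ n ∈ s, ‖f n x‖ ^ 2) :=
    fun s ε => (aemeasurable_const.add
      (Finset.aemeasurable_fun_sum s fun n _ => (hfm n).norm.pow_const 2)).sqrt
  have hm2 : ∀ s : Finset ι, AEMeasurable fun x => ∑ n ∈ s, inner ℝ (f n x) (h n x) :=
    fun s => Finset.aemeasurable_fun_sum s fun n _ =>
      ((hf n).aestronglyMeasurable.inner (hh n).aestronglyMeasurable).aemeasurable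
  have hL : Tendsto (fun p : Finset ι × ℝ =>
      ∫ x, partialDeriv j η x • √(p.2 + ∑ n ∈ p.1, ‖f n x‖ ^ 2)) (atTop ×ˢ 𝓝[>] 0)
      (𝓝 (∫ x, partialDeriv j η x • √(∑' n, ‖f n x‖ ^ 2))) := by
    -- For `ε < 1` the regularized root is at most `1 + √(∑ |fₙ|²)`, which is locally integrable.
    refine tendsto_integral_filter_of_dominated_convergence
      (fun x => ‖partialDeriv j η x • (1 + √(∑' n, ‖f n x‖ ^ 2))‖)
      (Eventually.of_forall fun p => ?_) ?_ ?_ ?_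
    · exact (hη.continuous_partialDeriv j).aestronglyMeasurable.smul
        (hm1 p.1 p.2).aestronglyMeasurable
    · filter_upwards [hlt] with p hp2
      filter_upwards [hfs] with x hx
      rw [norm_smul, norm_smul]
      gcongr
      rw [Real.norm_of_nonneg (Real.sqrt_nonneg _), Real.norm_of_nonneg (by positivity)]
      have hle := hx.sum_le_tsum p.1 fun n _ => sq_nonneg _
      have h0 : 0 ≤ ∑' n, ‖f n x‖ ^ 2 := tsum_nonneg fun n => sq_nonneg _
      refine Real.sqrt_le_iff.mpr ⟨by positivity, ?_⟩
      nlinarith [Real.sq_sqrt h0, Real.sqrt_nonneg (∑' n, ‖f n x‖ ^ 2)]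
    · exact (((locallyIntegrable_const (1 : ℝ)).add hfi).integrable_smul_left_of_hasCompactSupport
        (hη.continuous_partialDeriv j) (hη.hasCompactSupport_partialDeriv j)).norm
    · filter_upwards [hfs] with x hx
      have hε : Tendsto (fun p : Finset ι × ℝ => p.2) (atTop ×ˢ 𝓝[>] 0) (𝓝 0) :=
        (tendsto_snd.mono_right nhdsWithin_le_nhds)
      simpa using ((hε.add (hx.hasSum.comp tendsto_fst)).sqrt).const_mul (partialDeriv j η x)
  have hR : Tendsto (fun p : Finset ι × ℝ =>
      ∫ x, η x • ((∑ n ∈ p.1, inner ℝ (f n x) (h n x)) / √(p.2 + ∑ n ∈ p.1, ‖f n x‖ ^ 2)))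
      (atTop ×ˢ 𝓝[>] 0) (𝓝 (∫ x, η x • sqrtSumPartial f h x)) := by
    refine tendsto_integral_filter_of_dominated_convergence
      (fun x => ‖η x • √(∑' n, ‖h n x‖ ^ 2)‖) (Eventually.of_forall fun p => ?_) ?_ ?_ ?_
    · exact hη.continuous.aestronglyMeasurable.smul
        ((hm2 p.1).div (hm1 p.1 p.2)).aestronglyMeasurable
    · filter_upwards [hpos] with p hp
      filter_upwards [hhs] with x hx
      rw [norm_smul, norm_smul]
      gcongr
      rw [Real.norm_eq_abs, Real.norm_of_nonneg (Real.sqrt_nonneg _)]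
      exact abs_inner_div_sqrt_le_sqrt_tsum hx p.1 hp
    · exact (hhi.integrable_smul_left_of_hasCompactSupport hη.continuous hη.hasCompactSupport).norm
    · filter_upwards [hfs, hhs] with x hx hx'
      exact (tendsto_inner_div_sqrt hx hx').const_smul _
  refine tendsto_nhds_unique (hL.congr' ?_) hR.neg
  filter_upwards [hpos] with p hp
  exact hfin p.1 p.2 hp

end SqrtOfSum

/-! ### Multiplication operators on `L²`. -/

section MulOp

variable {d : ℕ}

theorem enorm_L2_sq (u : L2 d) : ‖u‖ₑ ^ 2 = ∫⁻ x, ‖u x‖ₑ ^ 2 := by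
  rw [Lp.enorm_def, eLpNorm_eq_lintegral_rpow_enorm_toReal (by norm_num) (by norm_num)]
  rw [← ENNReal.rpow_natCast, ← ENNReal.rpow_mul]
  simp

theorem enorm_star_complex (z : ℂ) : ‖star z‖ₑ = ‖z‖ₑ := by
  rw [enorm_eq_iff_norm_eq, norm_star]

theorem mulOp_coeFn {χ : Space d → ℂ} (hχ : MemLp χ ⊤ (volume : Measure (Space d))) (φ : L2 d) :
    mulOp χ φ =ᵐ[volume] fun x => χ x * φ x := by
  rw [mulOp, dif_pos hχ]
  refine ((ContinuousLinearMap.mul ℂ ℂ).coeFn_holder (r := 2) (hχ.toLp χ) φ).trans ?_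
  filter_upwards [hχ.coeFn_toLp] with x hx
  simp [hx]

theorem memLp_top_star {χ : Space d → ℂ} (hχ : MemLp χ ⊤ (volume : Measure (Space d))) :
    MemLp (fun x => star (χ x)) ⊤ (volume : Measure (Space d)) :=
  hχ.star

theorem adjoint_mulOp {χ : Space d → ℂ} (hχ : MemLp χ ⊤ (volume : Measure (Space d))) :
    (mulOp χ).adjoint = mulOp fun x => star (χ x) := by
  symm
  rw [ContinuousLinearMap.eq_adjoint_iff]
  intro φ ψ
  rw [L2.inner_def, L2.inner_def]
  refine integral_congr_ae ?_
  filter_upwards [mulOp_coeFn hχ ψ, mulOp_coeFn (memLp_top_star hχ) φ] with x h1 h2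
  rw [h1, h2]
  simp
  ring

theorem memLp_top_indicator {s : Set (Space d)} (hs : MeasurableSet s) :
    MemLp (s.indicator (1 : Space d → ℂ)) ⊤ (volume : Measure (Space d)) :=
  (memLp_top_const (1 : ℂ)).indicator hs

theorem adjoint_mulOp_indicator {s : Set (Space d)} (hs : MeasurableSet s) :
    (mulOp (s.indicator (1 : Space d → ℂ))).adjoint = mulOp (s.indicator 1) := by
  rw [adjoint_mulOp (memLp_top_indicator hs)]
  congr 1
  ext x
  by_cases hx : x ∈ s <;> simp [hx]

theorem mulOp_indicator_coeFn {s : Set (Space d)} (hs : MeasurableSet s) (φ : L2 d) :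
    mulOp (s.indicator 1) φ =ᵐ[volume] s.indicator φ := by
  refine (mulOp_coeFn (memLp_top_indicator hs) φ).trans (Eventually.of_forall fun x => ?_)
  by_cases hx : x ∈ s <;> simp [hx]

theorem isBoundedCutoff_indicator {s : Set (Space d)} (hs : MeasurableSet s)
    (hb : Bornology.IsBounded s) : IsBoundedCutoff (s.indicator (1 : Space d → ℂ)) where
  memLp := memLp_top_indicator hs
  hasCompactSupport := hb.isCompact_closure.of_isClosed_subset (isClosed_tsupport _)
    (closure_mono (support_indicator_subset))

theorem isPositive_mulOp_comp {χ : Space d → ℂ} (hχ : MemLp χ ⊤ (volume : Measure (Space d)))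
    (hre : ∀ x, star (χ x) = χ x) {A : L2 d →L[ℂ] L2 d} (hA : A.IsPositive) :
    (mulOp χ ∘L A ∘L mulOp χ).IsPositive := by
  have h := hA.conj_adjoint (mulOp χ)
  rw [adjoint_mulOp hχ] at h
  simpa only [hre] using h

theorem star_indicator_one (s : Set (Space d)) (x : Space d) :
    star (s.indicator (1 : Space d → ℂ) x) = s.indicator 1 x := by
  by_cases hx : x ∈ s <;> simp [hx]

end MulOp

/-! ### The density of a positive operator and the trace formula. -/

section Density

variable {d : ℕ}

instance secondCountableTopology_L2 : SecondCountableTopology (L2 d) :=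
  haveI : Fact ((2 : ℝ≥0∞) ≠ ⊤) := ⟨by norm_num⟩
  inferInstance

instance countable_basisIndex_L2 : Countable (basisIndex (L2 d)) := countable_basisIndex

/-- The density `∑ |√A e_n|²` of a positive operator, with values in `[0, ∞]`. -/
def edensity (A : L2 d →L[ℂ] L2 d) (x : Space d) : ℝ≥0∞ :=
  ∑' n, ‖(sqrtOp A (basis (L2 d) n)) x‖ₑ ^ 2

/-- The density `∑ |√A e_n|²` of a positive operator. -/
def density (A : L2 d →L[ℂ] L2 d) (x : Space d) : ℝ :=
  ∑' n, ‖(sqrtOp A (basis (L2 d) n)) x‖ ^ 2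

theorem density_nonneg (A : L2 d →L[ℂ] L2 d) (x : Space d) : 0 ≤ density A x :=
  tsum_nonneg fun _ => sq_nonneg _

theorem measurable_edensity (A : L2 d →L[ℂ] L2 d) : Measurable (edensity A) :=
  Measurable.tsum fun _ => (Lp.stronglyMeasurable _).measurable.enorm.pow_const 2

theorem toReal_edensity (A : L2 d →L[ℂ] L2 d) (x : Space d) : (edensity A x).toReal = density A x := by
  rw [edensity, density, ENNReal.tsum_toReal_eq fun n => by simp]
  simp

theorem measurable_density (A : L2 d →L[ℂ] L2 d) : Measurable (density A) := by
  rw [show density A = fun x => (edensity A x).toReal from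
    funext fun x => (toReal_edensity A x).symm]
  exact (measurable_edensity A).ennreal_toReal

theorem lintegral_mul_edensity (A : L2 d →L[ℂ] L2 d) {χ : Space d → ℂ}
    (hχ : MemLp χ ⊤ (volume : Measure (Space d))) :
    ∫⁻ x, ‖χ x‖ₑ ^ 2 * edensity A x = ∑' n, ‖mulOp χ (sqrtOp A (basis (L2 d) n))‖ₑ ^ 2 := by
  simp_rw [enorm_L2_sq]
  rw [← lintegral_tsum fun n => (Lp.aestronglyMeasurable _).enorm.pow_const 2]
  refine lintegral_congr_ae ?_
  have : ∀ᵐ x, ∀ n, mulOp χ (sqrtOp A (basis (L2 d) n)) x =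
      χ x * sqrtOp A (basis (L2 d) n) x := ae_all_iff.mpr fun n => mulOp_coeFn hχ _
  filter_upwards [this] with x hx
  simp only [hx, enorm_mul, mul_pow]
  rw [ENNReal.tsum_mul_left, edensity]

theorem adjoint_sqrt_comp_mulOp (A : L2 d →L[ℂ] L2 d) {χ : Space d → ℂ}
    (hχ : MemLp χ ⊤ (volume : Measure (Space d))) :
    (sqrtOp A ∘L mulOp χ).adjoint = mulOp (fun x => star (χ x)) ∘L sqrtOp A := by
  rw [ContinuousLinearMap.adjoint_comp, adjoint_mulOp hχ, adjoint_sqrtOp]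

/-- Passing to the adjoint moves the multiplication to the left of the root, where it acts pointwise
on the functions `√A eₙ`; Tonelli then sums their squares. -/
theorem tsum_enorm_sqrt_mulOp (A : L2 d →L[ℂ] L2 d) {χ : Space d → ℂ}
    (hχ : MemLp χ ⊤ (volume : Measure (Space d))) :
    ∑' n, ‖(sqrtOp A ∘L mulOp χ) (basis (L2 d) n)‖ₑ ^ 2 = ∫⁻ x, ‖χ x‖ₑ ^ 2 * edensity A x := by
  rw [tsum_enorm_apply_sq_adjoint, adjoint_sqrt_comp_mulOp A hχ]
  have := lintegral_mul_edensity A (memLp_top_star hχ)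
  simp only [enorm_star_complex] at this
  exact this.symm

/-- For real `χ`, `χAχ = (√A χ)* (√A χ)`. The identity holds in `[0, ∞]`, so finiteness of the trace
norm itself yields local integrability of the density. -/
theorem traceNorm_mulOp_comp {A : L2 d →L[ℂ] L2 d} (hA : A.IsPositive) {χ : Space d → ℂ}
    (hχ : MemLp χ ⊤ (volume : Measure (Space d))) (hre : ∀ x, star (χ x) = χ x) :
    traceNorm (mulOp χ ∘L A ∘L mulOp χ) = ∫⁻ x, ‖χ x‖ₑ ^ 2 * edensity A x := by
  rw [traceNorm_of_isPositive (isPositive_mulOp_comp hχ hre hA), ← tsum_enorm_sqrt_mulOp A hχ]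
  refine tsum_congr fun n => ?_
  have h1 : inner ℂ (basis (L2 d) n) ((mulOp χ ∘L A ∘L mulOp χ) (basis (L2 d) n)) =
      inner ℂ (mulOp χ (basis (L2 d) n)) (A (mulOp χ (basis (L2 d) n))) := by
    have := adjoint_mulOp hχ
    simp only [hre] at this
    rw [← ContinuousLinearMap.adjoint_inner_right (mulOp χ), this]
    rfl
  rw [h1, ← norm_sqrtOp_apply_sq hA, ENNReal.ofReal_pow (norm_nonneg _), ofReal_norm]
  rfl

theorem traceNorm_indicator {A : L2 d →L[ℂ] L2 d} (hA : A.IsPositive) {s : Set (Space d)}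
    (hs : MeasurableSet s) :
    traceNorm (mulOp (s.indicator 1) ∘L A ∘L mulOp (s.indicator 1)) = ∫⁻ x in s, edensity A x := by
  rw [traceNorm_mulOp_comp hA (memLp_top_indicator hs) (star_indicator_one s),
    ← lintegral_indicator hs]
  refine lintegral_congr fun x => ?_
  by_cases hx : x ∈ s <;> simp [hx]

/-- The density of `A` is locally integrable. -/
def HasLocallyFiniteDensity (A : L2 d →L[ℂ] L2 d) : Prop :=
  ∀ R : ℕ, ∫⁻ x in Metric.closedBall 0 R, edensity A x < ⊤

theorem HasLocallyFiniteDensity.lintegral_lt_top {A : L2 d →L[ℂ] L2 d}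
    (h : HasLocallyFiniteDensity A) {K : Set (Space d)} (hK : Bornology.IsBounded K) :
    ∫⁻ x in K, edensity A x < ⊤ := by
  obtain ⟨r, hr⟩ := hK.subset_closedBall 0
  obtain ⟨R, hR⟩ := exists_nat_ge r
  exact (lintegral_mono_set (hr.trans (Metric.closedBall_subset_closedBall hR))).trans_lt (h R)

theorem HasLocallyFiniteDensity.ae_lt_top {A : L2 d →L[ℂ] L2 d}
    (h : HasLocallyFiniteDensity A) : ∀ᵐ x, edensity A x < ⊤ := by
  have : ∀ R : ℕ, ∀ᵐ x, x ∈ Metric.closedBall 0 (R : ℝ) → edensity A x < ⊤ := fun R =>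
    (ae_restrict_iff' measurableSet_closedBall).mp
      (MeasureTheory.ae_lt_top (measurable_edensity A) (h R).ne)
  filter_upwards [ae_all_iff.mpr this] with x hx
  obtain ⟨R, hR⟩ := exists_nat_ge ‖x‖
  exact hx R (by simpa using hR)

theorem HasLocallyFiniteDensity.ae_summable {A : L2 d →L[ℂ] L2 d}
    (h : HasLocallyFiniteDensity A) :
    ∀ᵐ x, Summable fun n => ‖(sqrtOp A (basis (L2 d) n)) x‖ ^ 2 := by
  filter_upwards [h.ae_lt_top] with x hx
  exact (ENNReal.summable_toReal hx.ne).congr fun n => by simp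

theorem HasLocallyFiniteDensity.ae_enorm_density {A : L2 d →L[ℂ] L2 d}
    (h : HasLocallyFiniteDensity A) : ∀ᵐ x, ‖density A x‖ₑ = edensity A x := by
  filter_upwards [h.ae_lt_top] with x hx
  rw [Real.enorm_eq_ofReal (density_nonneg A x), ← toReal_edensity, ENNReal.ofReal_toReal hx.ne]

theorem HasLocallyFiniteDensity.locallyIntegrable {A : L2 d →L[ℂ] L2 d}
    (h : HasLocallyFiniteDensity A) : LocallyIntegrable (density A) := by
  rw [locallyIntegrable_iff]
  intro K hK
  refine ⟨(measurable_density A).aestronglyMeasurable, ?_⟩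
  rw [HasFiniteIntegral, lintegral_congr_ae (ae_restrict_of_ae h.ae_enorm_density)]
  exact h.lintegral_lt_top hK.isBounded

theorem locallyIntegrable_sqrt {u : Space d → ℝ} (hu : LocallyIntegrable u) :
    LocallyIntegrable fun x => √(u x) := by
  refine ((locallyIntegrable_const (1 : ℝ)).add (hu.mono hu.aestronglyMeasurable.norm
    (by simp))).mono hu.aestronglyMeasurable.aemeasurable.sqrt.aestronglyMeasurable
    (Eventually.of_forall fun x => ?_)
  rw [Real.norm_of_nonneg (Real.sqrt_nonneg _), Pi.add_apply, Real.norm_of_nonneg (by positivity)]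
  refine Real.sqrt_le_iff.mpr ⟨by positivity, ?_⟩
  nlinarith [le_abs_self (u x), Real.norm_eq_abs (u x), norm_nonneg (u x)]

theorem HasLocallyFiniteDensity.lintegral_mul_lt_top {A : L2 d →L[ℂ] L2 d}
    (h : HasLocallyFiniteDensity A) {χ : Space d → ℂ} (hχ : IsBoundedCutoff χ) :
    ∫⁻ x, ‖χ x‖ₑ ^ 2 * edensity A x < ⊤ := by
  have hb := ae_le_eLpNormEssSup (f := χ) (μ := (volume : Measure (Space d)))
  have hC : eLpNormEssSup χ (volume : Measure (Space d)) < ⊤ := by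
    simpa using hχ.memLp.2
  set C := eLpNormEssSup χ (volume : Measure (Space d))
  calc _ ≤ ∫⁻ x in tsupport χ, C ^ 2 * edensity A x := by
        rw [← lintegral_indicator (isClosed_tsupport χ).measurableSet]
        refine lintegral_mono_ae ?_
        filter_upwards [hb] with x hx
        by_cases hs : x ∈ tsupport χ
        · rw [indicator_of_mem hs]; gcongr
        · simp [image_eq_zero_of_notMem_tsupport hs]
    _ < ⊤ := by
        rw [lintegral_const_mul _ (measurable_edensity A)]
        exact ENNReal.mul_lt_top (ENNReal.pow_lt_top hC)
          (h.lintegral_lt_top hχ.hasCompactSupport.isCompact.isBounded)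

/-- The trace of `χ A χ` is the integral of `χ²` against the density of `A`. -/
theorem trace_mulOp_comp {A : L2 d →L[ℂ] L2 d} (hA : A.IsPositive)
    (h : HasLocallyFiniteDensity A) {χ : Space d → ℂ} (hχ : IsBoundedCutoff χ) :
    trace (mulOp χ ∘L A ∘L mulOp χ) = ∫ x, χ x ^ 2 * (density A x : ℂ) := by
  have hχs := memLp_top_star hχ.memLp
  have hfin := (h.lintegral_mul_lt_top hχ).ne
  set e := basis (L2 d)
  -- For complex `χ` the operator is `(√A χ̄)* (√A χ)`, which need not be positive; the trace is
  -- therefore a Hilbert–Schmidt inner product of two different operators.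
  have h1 : trace (mulOp χ ∘L A ∘L mulOp χ) =
      ∑' n, inner ℂ ((sqrtOp A ∘L mulOp fun x => star (χ x)) (e n))
        ((sqrtOp A ∘L mulOp χ) (e n)) := by
    refine tsum_congr fun n => ?_
    simp only [ContinuousLinearMap.comp_apply]
    rw [inner_sqrtOp_sqrtOp hA, ← adjoint_mulOp hχ.memLp, ContinuousLinearMap.adjoint_inner_left]
  rw [h1, tsum_inner_apply_adjoint (by
      rw [tsum_enorm_sqrt_mulOp A hχs]; simpa only [enorm_star_complex] using hfin)
    (by rw [tsum_enorm_sqrt_mulOp A hχ.memLp]; exact hfin),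
    adjoint_sqrt_comp_mulOp A hχ.memLp, adjoint_sqrt_comp_mulOp A hχs]
  simp only [star_star, ContinuousLinearMap.comp_apply]
  have h2 : ∀ n, inner ℂ (mulOp (fun x => star (χ x)) (sqrtOp A (e n)))
      (mulOp χ (sqrtOp A (e n))) = ∫ x, χ x ^ 2 * ((‖sqrtOp A (e n) x‖ ^ 2 : ℝ) : ℂ) := by
    intro n
    rw [L2.inner_def]
    refine integral_congr_ae ?_
    filter_upwards [mulOp_coeFn hχ.memLp (sqrtOp A (e n)),
      mulOp_coeFn hχs (sqrtOp A (e n))] with x h1 h2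
    rw [h1, h2]
    simp only [RCLike.inner_apply, map_mul, RCLike.star_def, RCLike.conj_conj]
    rw [← Complex.normSq_eq_norm_sq, ← Complex.mul_conj]
    ring
  refine (tsum_congr h2).trans ?_
  have hm : ∀ n, AEStronglyMeasurable
      (fun x => χ x ^ 2 * ((‖sqrtOp A (e n) x‖ ^ 2 : ℝ) : ℂ)) volume := fun n =>
    (hχ.memLp.1.pow 2).mul (Complex.continuous_ofReal.comp_aestronglyMeasurable
      ((Lp.aestronglyMeasurable _).norm.pow 2))
  have hen : ∀ n x, ‖χ x ^ 2 * ((‖sqrtOp A (e n) x‖ ^ 2 : ℝ) : ℂ)‖ₑ =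
      ‖χ x‖ₑ ^ 2 * ‖sqrtOp A (e n) x‖ₑ ^ 2 := fun n x => by
    rw [enorm_mul, enorm_pow, Complex.ofReal_pow, enorm_pow]
    congr 2
    rw [enorm_eq_iff_norm_eq, Complex.norm_real, norm_norm]
  rw [← integral_tsum hm]
  · refine integral_congr_ae (Eventually.of_forall fun x => ?_)
    simp only [density]
    rw [tsum_mul_left, Complex.ofReal_tsum]
  · simp_rw [hen]
    have hm2 : ∀ n, AEMeasurable fun x => ‖χ x‖ₑ ^ 2 * ‖sqrtOp A (e n) x‖ₑ ^ 2 := fun n =>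
      (hχ.memLp.1.enorm.pow_const 2).mul ((Lp.aestronglyMeasurable _).enorm.pow_const 2)
    rw [← lintegral_tsum hm2]
    simp_rw [ENNReal.tsum_mul_left]
    exact hfin

end Density

/-! ### The momentum operators on test functions, and density of test functions in `L²(O)`. -/

section Momentum

variable {d : ℕ}

theorem IsTest.memLp {φ : Space d → ℂ} (hφ : IsTest φ) : MemLp φ 2 (volume : Measure (Space d)) :=
  hφ.continuous.memLp_of_hasCompactSupport hφ.hasCompactSupport

theorem IsTest.memLp_momentum {φ : Space d → ℂ} (hφ : IsTest φ) (j : Fin d) :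
    MemLp (fun x => -Complex.I * partialDeriv j φ x) 2 (volume : Measure (Space d)) :=
  ((hφ.continuous_partialDeriv j).memLp_of_hasCompactSupport
    (hφ.hasCompactSupport_partialDeriv j)).const_mul _

theorem IsTest.ofReal {η : Space d → ℝ} (hη : IsTest η) : IsTest fun x => (η x : ℂ) where
  contDiff := Complex.ofRealCLM.contDiff.comp hη.contDiff
  hasCompactSupport := hη.hasCompactSupport.comp_left Complex.ofReal_zero

theorem tsupport_ofReal (η : Space d → ℝ) : tsupport (fun x => (η x : ℂ)) = tsupport η := by
  simp [tsupport, Function.support]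

theorem partialDeriv_ofReal {η : Space d → ℝ} (hη : IsTest η) (j : Fin d) (x : Space d) :
    partialDeriv j (fun x => (η x : ℂ)) x = ((partialDeriv j η x : ℝ) : ℂ) := by
  have h := (Complex.ofRealCLM.hasFDerivAt.comp x (hη.differentiableAt x).hasFDerivAt).fderiv
  rw [partialDeriv, partialDeriv, show (fun x => (η x : ℂ)) = Complex.ofRealCLM ∘ η from rfl, h]
  rfl

theorem partialDeriv_conj {φ : Space d → ℂ} (hφ : IsTest φ) (j : Fin d) (x : Space d) :
    partialDeriv j (fun x => starRingEnd ℂ (φ x)) x = starRingEnd ℂ (partialDeriv j φ x) := by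
  have h := (Complex.conjCLE.toContinuousLinearMap.hasFDerivAt.comp x
    (hφ.differentiableAt x).hasFDerivAt).fderiv
  rw [partialDeriv, partialDeriv,
    show (fun x => starRingEnd ℂ (φ x)) = Complex.conjCLE.toContinuousLinearMap ∘ φ from rfl, h]
  rfl

theorem IsTest.conj {φ : Space d → ℂ} (hφ : IsTest φ) : IsTest fun x => starRingEnd ℂ (φ x) where
  contDiff := Complex.conjCLE.contDiff.comp hφ.contDiff
  hasCompactSupport := hφ.hasCompactSupport.comp_left (map_zero _)

theorem integral_mul_partialDeriv {φ ψ : Space d → ℂ} (hφ : IsTest φ) (hψ : IsTest ψ) (j : Fin d) :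
    ∫ x, φ x * partialDeriv j ψ x = -∫ x, partialDeriv j φ x * ψ x := by
  refine integral_mul_fderiv_eq_neg_fderiv_mul_of_integrable (μ := volume) ?_ ?_ ?_
    (fun x _ => hφ.differentiableAt x) (fun x _ => hψ.differentiableAt x)
  · exact ((hφ.continuous_partialDeriv j).mul hψ.continuous).integrable_of_hasCompactSupport
      (hψ.hasCompactSupport.mul_left)
  · exact (hφ.continuous.mul (hψ.continuous_partialDeriv j)).integrable_of_hasCompactSupport
      (hφ.hasCompactSupport.mul_right)
  · exact (hφ.continuous.mul hψ.continuous).integrable_of_hasCompactSupport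
      (hφ.hasCompactSupport.mul_right)

theorem mem_momentumGraph_of_isTest {φ : Space d → ℂ} (hφ : IsTest φ) (j : Fin d) {u v : L2 d}
    (hu : u =ᵐ[volume] φ) (hv : v =ᵐ[volume] fun x => -Complex.I * partialDeriv j φ x) :
    (u, v) ∈ momentumGraph j := by
  intro η hη u' v' hu' hv'
  rw [L2.inner_def, L2.inner_def]
  have e1 : ∫ x, inner ℂ (u' x) (v x) =
      -Complex.I * ∫ x, starRingEnd ℂ (η x) * partialDeriv j φ x := by
    rw [← integral_const_mul]
    refine integral_congr_ae ?_
    filter_upwards [hu', hv] with x h1 h2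
    rw [h1, h2]
    simp
    ring
  have e2 : ∫ x, inner ℂ (v' x) (u x) =
      Complex.I * ∫ x, partialDeriv j (fun x => starRingEnd ℂ (η x)) x * φ x := by
    rw [← integral_const_mul]
    refine integral_congr_ae ?_
    filter_upwards [hv', hu] with x h1 h2
    rw [h1, h2, partialDeriv_conj hη]
    simp
    ring
  simp only
  rw [e1, e2, integral_mul_partialDeriv hη.conj hφ]
  ring

theorem momentum_graph (j : Fin d) : (momentum (d := d) j).graph = momentumGraph j :=
  Submodule.toLinearPMap_graph_eq _ fun p hp => momentumGraph_singleValued j p hp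

theorem momentum_apply_of_mem {j : Fin d} {u v : L2 d} (h : (u, v) ∈ momentumGraph j)
    (u' : (momentum (d := d) j).domain) (hu' : (u' : L2 d) = u) : momentum j u' = v := by
  rw [← momentum_graph, LinearPMap.mem_graph_iff] at h
  obtain ⟨y, hy1, hy2⟩ := h
  have : u' = y := Subtype.ext (hu'.trans hy1.symm)
  rw [this]
  exact hy2

/-- The test functions supported in `O`, as a subspace of `L²`. -/
def testSubmodule (O : Set (Space d)) : Submodule ℂ (L2 d) where
  carrier := {u | ∃ φ : Space d → ℂ, IsTest φ ∧ tsupport φ ⊆ O ∧ u =ᵐ[volume] φ}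
  add_mem' := by
    rintro u v ⟨φ, hφ, hφO, hu⟩ ⟨ψ, hψ, hψO, hv⟩
    exact ⟨φ + ψ, ⟨hφ.contDiff.add hψ.contDiff, hφ.hasCompactSupport.add hψ.hasCompactSupport⟩,
      (tsupport_add φ ψ).trans (union_subset hφO hψO), (Lp.coeFn_add u v).trans (hu.add hv)⟩
  zero_mem' := ⟨0, ⟨contDiff_const, HasCompactSupport.zero⟩, by simp [tsupport],
    Lp.coeFn_zero _ _ _⟩
  smul_mem' := by
    rintro c u ⟨φ, hφ, hφO, hu⟩
    exact ⟨c • φ, ⟨hφ.contDiff.const_smul c, hφ.hasCompactSupport.smul_left⟩,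
      (closure_mono (Function.support_const_smul_subset c φ)).trans hφO,
      (Lp.coeFn_smul c u).trans (hu.const_smul c)⟩

theorem testSubmodule_le_domain (O : Set (Space d)) (j : Fin d) :
    testSubmodule O ≤ (momentum (d := d) j).domain := by
  rintro u ⟨φ, hφ, -, hu⟩
  rw [LinearPMap.mem_domain_iff]
  exact ⟨(hφ.memLp_momentum j).toLp _, by
    rw [momentum_graph]
    exact mem_momentumGraph_of_isTest hφ j hu (MemLp.coeFn_toLp _)⟩

/-- The momentum operator on test functions supported in `O`. -/
def testMomentum (O : Set (Space d)) (j : Fin d) : testSubmodule O →ₗ[ℂ] L2 d :=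
  (momentum j).toFun ∘ₗ Submodule.inclusion (testSubmodule_le_domain O j)

theorem testMomentum_coeFn {O : Set (Space d)} {j : Fin d} (u : testSubmodule O)
    {φ : Space d → ℂ} (hφ : IsTest φ) (hu : (u : L2 d) =ᵐ[volume] φ) :
    testMomentum O j u =ᵐ[volume] fun x => -Complex.I * partialDeriv j φ x := by
  have h : testMomentum O j u = (hφ.memLp_momentum j).toLp _ :=
    momentum_apply_of_mem (mem_momentumGraph_of_isTest hφ j hu (MemLp.coeFn_toLp _)) _ rfl
  rw [h]
  exact MemLp.coeFn_toLp _

/-- The fundamental lemma of the calculus of variations; real test functions, viewed as complex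
ones, suffice. -/
theorem ae_eq_zero_of_mem_orthogonal {O : Set (Space d)} (hO : IsOpen O) {w : L2 d}
    (hw : w ∈ (testSubmodule O)ᗮ) : ∀ᵐ x, x ∈ O → w x = 0 := by
  refine hO.ae_eq_zero_of_integral_contDiff_smul_eq_zero
    (((Lp.memLp w).locallyIntegrable (by norm_num)).locallyIntegrableOn O) ?_
  intro g hg hgs hgO
  have ht : IsTest g := ⟨hg, hgs⟩
  have h := (Submodule.mem_orthogonal _ _).mp hw (ht.ofReal.memLp.toLp _)
    ⟨_, ht.ofReal, (tsupport_ofReal g).trans_subset hgO, MemLp.coeFn_toLp _⟩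
  rw [L2.inner_def] at h
  rw [← h]
  refine integral_congr_ae ?_
  filter_upwards [ht.ofReal.memLp.coeFn_toLp] with x hx
  rw [hx]
  simp [mul_comm]

/-- The closure is the double orthogonal complement, and a vector orthogonal to the test functions
vanishes on `O`, hence is orthogonal to `ψ`. -/
theorem mem_closure_testSubmodule {O : Set (Space d)} (hO : IsOpen O) {ψ : L2 d}
    (hψ : ∀ᵐ x, x ∉ O → ψ x = 0) : ψ ∈ (testSubmodule O).topologicalClosure := by
  rw [← Submodule.orthogonal_orthogonal_eq_closure, Submodule.mem_orthogonal]
  intro w hw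
  rw [L2.inner_def]
  refine integral_eq_zero_of_ae ?_
  filter_upwards [hψ, ae_eq_zero_of_mem_orthogonal hO hw] with x h1 h2
  by_cases hx : x ∈ O
  · simp [h2 hx]
  · simp [h1 hx]

end Momentum

/-! ### The localized operator `1_s P_j A P_j 1_s` and the local inequality. -/

section Sandwich

variable {d : ℕ}

/-- The measurable set `s` agrees with its open subset `O` up to a null set. -/
structure IsAlmostOpen (s O : Set (Space d)) : Prop where
  isOpen : IsOpen O
  subset : O ⊆ s
  measurableSet : MeasurableSet s
  measure_diff : volume (s \ O) = 0

theorem IsAlmostOpen.mulOp_eq_self {s O : Set (Space d)} (h : IsAlmostOpen s O) {u : L2 d}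
    (hu : u ∈ testSubmodule O) : mulOp (s.indicator 1) u = u := by
  obtain ⟨φ, -, hφO, hu⟩ := hu
  refine Lp.ext ?_
  filter_upwards [mulOp_indicator_coeFn h.measurableSet u, hu] with x h1 h2
  rw [h1]
  by_cases hx : x ∈ s
  · rw [indicator_of_mem hx]
  · rw [indicator_of_notMem hx, h2,
      image_eq_zero_of_notMem_tsupport fun hx' => hx (h.subset (hφO hx'))]

/-- Since `s \ O` is null, `L²(s)` and `L²(O)` coincide, so an operator cut off by `1_s` is
determined by test functions supported in `O`. -/
theorem IsAlmostOpen.mulOp_mem_closure {s O : Set (Space d)} (h : IsAlmostOpen s O) (ψ : L2 d) :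
    mulOp (s.indicator 1) ψ ∈ (testSubmodule O).topologicalClosure := by
  refine mem_closure_testSubmodule h.isOpen ?_
  have hn : ∀ᵐ x, x ∉ s \ O := measure_eq_zero_iff_ae_notMem.mp h.measure_diff
  filter_upwards [mulOp_indicator_coeFn h.measurableSet ψ, hn] with x h1 h2 hx
  rw [h1, indicator_of_notMem fun hs => h2 ⟨hs, hx⟩]

theorem IsAlmostOpen.mulOp_eq_zero {s O : Set (Space d)} (h : IsAlmostOpen s O) {w : L2 d}
    (hw : w ∈ (testSubmodule O)ᗮ) : mulOp (s.indicator 1) w = 0 := by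
  refine Lp.ext ?_
  have hn : ∀ᵐ x, x ∉ s \ O := measure_eq_zero_iff_ae_notMem.mp h.measure_diff
  filter_upwards [mulOp_indicator_coeFn h.measurableSet w, hn,
    ae_eq_zero_of_mem_orthogonal h.isOpen hw, Lp.coeFn_zero ℂ 2 (volume : Measure (Space d))]
    with x h1 h2 h3 h4
  rw [h1, h4]
  by_cases hx : x ∈ s
  · rw [indicator_of_mem hx, h3 (by_contra fun hO => h2 ⟨hx, hO⟩)]
    rfl
  · rw [indicator_of_notMem hx]
    rfl

variable {j : Fin d} {A T : L2 d →L[ℂ] L2 d} {s O : Set (Space d)}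

/-- Test functions supported in `O ⊆ s` are fixed by `1_s` and by the smooth cutoff, which equals
`1` there. On them the sandwich is the bare form `P_j A P_j`, whatever cutoff was chosen. -/
theorem IsMomentumSandwich.inner_test (hT : IsMomentumSandwich j A (s.indicator 1) T)
    (h : IsAlmostOpen s O) (u v : testSubmodule O) :
    inner ℂ (u : L2 d) (T v) = inner ℂ (testMomentum O j u) (A (testMomentum O j v)) := by
  obtain ⟨η, hη, hη1, S, hS, rfl⟩ := hT
  simp only [ContinuousLinearMap.comp_apply]
  rw [← ContinuousLinearMap.adjoint_inner_left, adjoint_mulOp_indicator h.measurableSet,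
    h.mulOp_eq_self u.2, h.mulOp_eq_self v.2]
  have hηm : MemLp η ⊤ (volume : Measure (Space d)) :=
    hη.continuous.memLp_of_hasCompactSupport hη.hasCompactSupport
  have hη1' : ∀ x ∈ O, η x = 1 := by
    intro x hx
    refine hη1.self_of_nhdsSet x (subset_tsupport _ ?_)
    simp [h.subset hx]
  have hmul : ∀ w : testSubmodule O, mulOp η w = w ∧ mulOp (fun x => star (η x)) w = w := by
    rintro ⟨w, φ, -, hφO, hw⟩
    have key : ∀ᵐ x, w x ≠ 0 → η x = 1 := by
      filter_upwards [hw] with x hx h0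
      refine hη1' x (hφO (subset_tsupport _ ?_))
      rwa [hx] at h0
    constructor
    · refine Lp.ext ?_
      filter_upwards [mulOp_coeFn hηm w, key] with x h1 h2
      rw [h1]
      by_cases h0 : w x = 0
      · simp [h0]
      · simp [h2 h0]
    · refine Lp.ext ?_
      filter_upwards [mulOp_coeFn (memLp_top_star hηm) w, key] with x h1 h2
      rw [h1]
      by_cases h0 : w x = 0
      · simp [h0]
      · simp [h2 h0]
  exact hS u v (testSubmodule_le_domain O j u.2) (testSubmodule_le_domain O j v.2)
    (Submodule.inclusion (testSubmodule_le_domain O j) u)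
    (Submodule.inclusion (testSubmodule_le_domain O j) v) (hmul u).2.symm (hmul v).1.symm

theorem mulOp_indicator_idem (hs : MeasurableSet s) (ψ : L2 d) :
    mulOp (s.indicator 1) (mulOp (s.indicator 1) ψ) = mulOp (s.indicator 1) ψ := by
  refine Lp.ext ?_
  filter_upwards [mulOp_indicator_coeFn hs (mulOp (s.indicator 1) ψ),
    mulOp_indicator_coeFn hs ψ] with x h1 h2
  rw [h1]
  by_cases hx : x ∈ s
  · rw [indicator_of_mem hx]
  · rw [h2, indicator_of_notMem hx, indicator_of_notMem hx]

theorem IsMomentumSandwich.inner_mulOp (hT : IsMomentumSandwich j A (s.indicator 1) T)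
    (hs : MeasurableSet s) (u v : L2 d) :
    inner ℂ (mulOp (s.indicator 1) u) (T (mulOp (s.indicator 1) v)) = inner ℂ u (T v) := by
  obtain ⟨η, hη, hη1, S, hS, rfl⟩ := hT
  simp only [ContinuousLinearMap.comp_apply]
  rw [← adjoint_mulOp_indicator hs, ContinuousLinearMap.adjoint_inner_left,
    adjoint_mulOp_indicator hs, mulOp_indicator_idem hs, mulOp_indicator_idem hs]

/-- The form is `⟨P_j u, A P_j u⟩ ≥ 0` on test functions; nonnegativity is a closed condition and
passes to their closure, which contains the range of `1_s`. -/
theorem IsMomentumSandwich.isPositive (hT : IsMomentumSandwich j A (s.indicator 1) T)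
    (h : IsAlmostOpen s O) (hA : A.IsPositive) : T.IsPositive := by
  have key : ∀ ψ : L2 d, 0 ≤ (inner ℂ ψ (T ψ) : ℂ).re ∧ (inner ℂ ψ (T ψ) : ℂ).im = 0 := by
    intro ψ
    rw [← hT.inner_mulOp h.measurableSet]
    have hcl : IsClosed {v : L2 d | 0 ≤ (inner ℂ v (T v) : ℂ).re ∧ (inner ℂ v (T v) : ℂ).im = 0} := by
      have hc : Continuous fun v : L2 d => inner ℂ v (T v) := by fun_prop
      exact (isClosed_le continuous_const (Complex.continuous_re.comp hc)).inter
        (isClosed_eq (Complex.continuous_im.comp hc) continuous_const)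
    refine closure_minimal ?_ hcl (h.mulOp_mem_closure ψ)
    intro u hu
    have := hT.inner_test h ⟨u, hu⟩ ⟨u, hu⟩
    simp only at this
    rw [mem_ofPred_eq, this, ← inner_eq_re_of_isPositive hA]
    exact ⟨by simpa using re_inner_nonneg_of_isPositive hA _, by simp⟩
  rw [ContinuousLinearMap.isPositive_iff_complex]
  intro ψ
  have h1 := key ψ
  have h2 : inner ℂ (T ψ) ψ = starRingEnd ℂ (inner ℂ ψ (T ψ)) := (inner_conj_symm _ _).symm
  have h3 : (inner ℂ (T ψ) ψ : ℂ).im = 0 := by rw [h2, Complex.conj_im, h1.2, neg_zero]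
  have h4 : 0 ≤ (inner ℂ (T ψ) ψ : ℂ).re := by rw [h2, Complex.conj_re]; exact h1.1
  exact ⟨Complex.ext (by simp) (by simp [h3]), h4⟩

/-- The operator `√A P_j` on `O`. -/
theorem IsMomentumSandwich.exists_sqrt_momentum (hT : IsMomentumSandwich j A (s.indicator 1) T)
    (h : IsAlmostOpen s O) (hA : A.IsPositive) : ∃ C : L2 d →L[ℂ] L2 d,
      (∀ ψ, ‖C ψ‖ ^ 2 = (inner ℂ ψ (T ψ) : ℂ).re) ∧
      ∀ u : testSubmodule O, C u = sqrtOp A (testMomentum O j u) := by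
  set V := testSubmodule O
  set K := V.topologicalClosure
  have hVK : V ≤ K := V.le_topologicalClosure
  let f : V →ₗ[ℂ] L2 d := (sqrtOp A).toLinearMap ∘ₗ testMomentum O j
  let e : V →ₗ[ℂ] K := Submodule.inclusion hVK
  have hf : ∀ u : V, ‖f u‖ ^ 2 = (inner ℂ (u : L2 d) (T u) : ℂ).re := by
    intro u
    rw [hT.inner_test h u u]
    exact norm_sqrtOp_apply_sq hA _
  have hdense : DenseRange e := by
    have := (denseRange_inclusion_iff (s := (V : Set (L2 d))) (t := (K : Set (L2 d))) hVK).mpr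
      (by rw [Submodule.topologicalClosure_coe])
    exact this
  -- Although `P_j` is unbounded, `‖√A P_j u‖² = ⟨u, Tu⟩ ≤ ‖T‖ ‖u‖²`, so `√A P_j` extends
  -- continuously to the closure of the test functions.
  have hnorm : ∀ u : V, ‖f u‖ ≤ √‖T‖ * ‖e u‖ := by
    intro u
    have h1 : ‖f u‖ ^ 2 ≤ ‖T‖ * ‖(u : L2 d)‖ ^ 2 := by
      rw [hf u]
      calc _ ≤ ‖(inner ℂ (u : L2 d) (T u) : ℂ)‖ := Complex.re_le_norm _
        _ ≤ ‖(u : L2 d)‖ * ‖T u‖ := norm_inner_le_norm _ _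
        _ ≤ ‖(u : L2 d)‖ * (‖T‖ * ‖(u : L2 d)‖) := by gcongr; exact T.le_opNorm _
        _ = _ := by ring
    refine le_of_sq_le_sq ?_ (by positivity)
    rw [mul_pow, Real.sq_sqrt (norm_nonneg _)]
    exact h1
  let C₀ : K →L[ℂ] L2 d := f.extendOfNorm e
  have hC₀ : ∀ u, C₀ (e u) = f u := f.extendOfNorm_eq hdense ⟨_, hnorm⟩
  have hC₀n : ∀ k : K, ‖C₀ k‖ ^ 2 = (inner ℂ (k : L2 d) (T k) : ℂ).re := by
    intro k
    refine hdense.induction_on (p := fun k : K => ‖C₀ k‖ ^ 2 = (inner ℂ (k : L2 d) (T k) : ℂ).re)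
      k ?_ ?_
    · refine isClosed_eq (by fun_prop) (Complex.continuous_re.comp ?_)
      exact continuous_subtype_val.inner (T.continuous.comp continuous_subtype_val)
    · intro u
      rw [hC₀, hf]
      rfl
  -- The extension by zero to the orthogonal complement is consistent with `T`, because `1_s`
  -- annihilates that complement.
  refine ⟨C₀ ∘L K.orthogonalProjectionOnto, fun ψ => ?_, fun u => ?_⟩
  · rw [ContinuousLinearMap.comp_apply, hC₀n]
    have hperp : ψ - K.orthogonalProjectionOnto ψ ∈ Vᗮ := by
      rw [← Submodule.orthogonal_closure]
      exact K.sub_starProjection_mem_orthogonal ψ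
    have hz := h.mulOp_eq_zero hperp
    rw [map_sub, sub_eq_zero] at hz
    rw [← hT.inner_mulOp h.measurableSet, ← hT.inner_mulOp h.measurableSet ψ ψ, hz]
  · rw [ContinuousLinearMap.comp_apply]
    have : K.orthogonalProjectionOnto (u : L2 d) = e u :=
      Submodule.orthogonalProjectionOnto_mem_subspace_eq_self (e u)
    rw [this, hC₀]
    rfl

/-- A local version of the Hoffmann-Ostenhof inequality. -/
theorem IsMomentumSandwich.exists_weakPartial (hT : IsMomentumSandwich j A (s.indicator 1) T)
    (h : IsAlmostOpen s O) (hA : A.IsPositive) (hd : HasLocallyFiniteDensity A)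
    (hfin : traceNorm T ≠ ⊤) : ∃ g : Space d → ℝ, LocallyIntegrable g ∧
      HasWeakPartialOn O j (fun x => √(density A x)) g ∧ ∫⁻ x, ‖g x‖ₑ ^ 2 ≤ traceNorm T := by
  obtain ⟨C, hC1, hC2⟩ := hT.exists_sqrt_momentum h hA
  set e := basis (L2 d)
  let f : basisIndex (L2 d) → Space d → ℂ := fun n => sqrtOp A (e n)
  -- `C*` represents `P_j √A` on `O`, and `∂_j = i P_j`; hence the factor `i`.
  let p : basisIndex (L2 d) → Space d → ℂ := fun n x => Complex.I * (C.adjoint (e n)) x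
  -- The Hilbert–Schmidt norm of `C*` equals that of `C`, whose square is `Tr T` because `‖Cψ‖² =
  -- ⟨ψ, Tψ⟩`.
  have hsum : ∑' n, ‖C.adjoint (e n)‖ₑ ^ 2 = traceNorm T := by
    rw [← tsum_enorm_apply_sq_adjoint, traceNorm_of_isPositive (hT.isPositive h hA)]
    refine tsum_congr fun n => ?_
    rw [← hC1, ENNReal.ofReal_pow (norm_nonneg _), ofReal_norm]
  have hpen : ∀ n x, ‖p n x‖ₑ = ‖(C.adjoint (e n)) x‖ₑ := fun n x => by
    rw [enorm_eq_iff_norm_eq]; simp [p]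
  have hpm : ∀ n, StronglyMeasurable (p n) := fun n =>
    stronglyMeasurable_const.mul (Lp.stronglyMeasurable _)
  have hlint : ∫⁻ x, ∑' n, ‖p n x‖ₑ ^ 2 = traceNorm T := by
    simp_rw [hpen]
    rw [lintegral_tsum fun n => (Lp.aestronglyMeasurable _).enorm.pow_const 2, ← hsum]
    simp_rw [enorm_L2_sq]
  have hpmeas : Measurable fun x => ∑' n, ‖p n x‖ₑ ^ 2 :=
    Measurable.tsum fun n => (hpm n).measurable.enorm.pow_const 2
  have hplt : ∀ᵐ x, ∑' n, ‖p n x‖ₑ ^ 2 < ⊤ := ae_lt_top hpmeas (by rw [hlint]; exact hfin)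
  have hps : ∀ᵐ x, Summable fun n => ‖p n x‖ ^ 2 := by
    filter_upwards [hplt] with x hx
    exact (ENNReal.summable_toReal hx.ne).congr fun n => by simp
  have hreal : ∀ x, ∑' n, ‖p n x‖ ^ 2 = (∑' n, ‖p n x‖ₑ ^ 2).toReal := fun x => by
    rw [ENNReal.tsum_toReal_eq fun n => by simp]
    simp
  have hpi : LocallyIntegrable fun x => √(∑' n, ‖p n x‖ ^ 2) := by
    refine locallyIntegrable_sqrt (Integrable.locallyIntegrable ?_)
    simp_rw [hreal]
    exact integrable_toReal_of_lintegral_ne_top hpmeas.aemeasurable (by rw [hlint]; exact hfin)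
  have hfl : ∀ n, LocallyIntegrable (f n) := fun n => (Lp.memLp _).locallyIntegrable (by norm_num)
  have hpl : ∀ n, LocallyIntegrable (p n) := fun n =>
    ((Lp.memLp (C.adjoint (e n))).const_mul Complex.I).locallyIntegrable (by norm_num)
  -- Testing against real `η` supported in `O`: `⟨η, C* eₙ⟩ = ⟨Cη, eₙ⟩ = ⟨√A P_j η, eₙ⟩ = ⟨P_j η, √A
  -- eₙ⟩`.
  have hw : ∀ n, HasWeakPartialOn O j (f n) (p n) := by
    intro n η hη hηO
    let u : testSubmodule O := ⟨hη.ofReal.memLp.toLp _, _, hη.ofReal,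
      (tsupport_ofReal η).trans_subset hηO, MemLp.coeFn_toLp _⟩
    have h1 : inner ℂ (u : L2 d) (C.adjoint (e n)) =
        inner ℂ (testMomentum O j u) (sqrtOp A (e n)) := by
      rw [ContinuousLinearMap.adjoint_inner_right, hC2 u,
        ← ContinuousLinearMap.adjoint_inner_right (sqrtOp A), adjoint_sqrtOp]
    have h2 : inner ℂ (u : L2 d) (C.adjoint (e n)) =
        -Complex.I * ∫ x, η x • p n x := by
      rw [L2.inner_def, ← integral_const_mul]
      refine integral_congr_ae ?_
      filter_upwards [hη.ofReal.memLp.coeFn_toLp] with x hx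
      simp only [u, p]
      rw [hx]
      simp only [RCLike.inner_apply, Complex.conj_ofReal, Complex.real_smul]
      linear_combination (η x : ℂ) * (C.adjoint (e n)) x * Complex.I_mul_I
    have h3 : inner ℂ (testMomentum O j u) (sqrtOp A (e n)) =
        Complex.I * ∫ x, partialDeriv j η x • f n x := by
      rw [L2.inner_def, ← integral_const_mul]
      refine integral_congr_ae ?_
      filter_upwards [testMomentum_coeFn (j := j) u hη.ofReal hη.ofReal.memLp.coeFn_toLp] with x hx
      rw [hx, partialDeriv_ofReal hη]
      simp [f]
      ring
    rw [h2, h3] at h1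
    have h4 : Complex.I * ((∫ x, partialDeriv j η x • f n x) + ∫ x, η x • p n x) = 0 := by
      linear_combination -h1
    rw [mul_eq_zero, or_iff_right Complex.I_ne_zero] at h4
    exact eq_neg_of_add_eq_zero_left h4
  have hbd : ∀ᵐ x, |sqrtSumPartial f p x| ≤ √(∑' n, ‖p n x‖ ^ 2) := by
    filter_upwards [hd.ae_summable, hps] with x h1 h2
    exact abs_sqrtSumPartial_le h1 h2
  have hmeas : Measurable (sqrtSumPartial f p) := by
    refine Measurable.div (Measurable.tsum fun n => ?_) (Measurable.sqrt (Measurable.tsum fun n => ?_))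
    · exact ((Lp.stronglyMeasurable _).inner (hpm n)).measurable
    · exact (Lp.stronglyMeasurable _).measurable.norm.pow_const 2
  refine ⟨sqrtSumPartial f p, hpi.mono hmeas.aestronglyMeasurable ?_, ?_, ?_⟩
  · filter_upwards [hbd] with x hx
    rwa [Real.norm_eq_abs, Real.norm_of_nonneg (Real.sqrt_nonneg _)]
  · exact hasWeakPartialOn_sqrt_tsum h.isOpen hfl hpl hw hd.ae_summable hps
      (locallyIntegrable_sqrt hd.locallyIntegrable) hpi
  · rw [← hlint]
    refine lintegral_mono_ae ?_
    filter_upwards [hbd, hplt] with x hx hlt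
    rw [← ENNReal.ofReal_toReal hlt.ne, ← hreal, ← ofReal_norm, ← ENNReal.ofReal_pow (norm_nonneg _)]
    refine ENNReal.ofReal_le_ofReal ?_
    rw [Real.norm_eq_abs, ← Real.sq_sqrt (tsum_nonneg fun n => sq_nonneg ‖p n x‖)]
    gcongr

end Sandwich

/-! ### A canonical representative of the weak gradient. -/

section MollifiedGradient

variable {d : ℕ}

theorem HasWeakPartialOn.ae_tendsto_partialDeriv_mollify {O : Set (Space d)} (hO : IsOpen O)
    {j : Fin d} {u g : Space d → ℝ} (h : HasWeakPartialOn O j u g) (hu : LocallyIntegrable u)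
    (hg : LocallyIntegrable g) :
    ∀ᵐ x, x ∈ O → Tendsto (fun n => partialDeriv j (mollify n u) x) atTop (𝓝 (g x)) := by
  filter_upwards [ae_tendsto_mollify hg] with x hx hxO
  obtain ⟨r, hr, hrO⟩ := Metric.isOpen_iff.mp hO x hxO
  refine hx.congr' ?_
  filter_upwards [(tendsto_bump_rOut d).eventually_lt_const hr] with n hn
  exact (h.partialDeriv_mollify hu ((Metric.closedBall_subset_ball hn).trans hrO)).symm

/-- The pointwise limit of the gradients of the mollifications of `u`. -/
def limGradient (u : Space d → ℝ) (x : Space d) : Space d :=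
  WithLp.toLp 2 fun j =>
    limsup (fun n => ∫ y, partialDeriv j (mollifier d n) (x - y) * u y) atTop

/-- Only integrals of `u` enter the definition, so the equality holds at every point. This allows
the density to be replaced by a jointly measurable version. -/
theorem limGradient_congr {u v : Space d → ℝ} (h : u =ᵐ[volume] v) :
    limGradient u = limGradient v := by
  ext x j
  simp only [limGradient]
  congr 1
  ext n
  refine integral_congr_ae ?_
  filter_upwards [h] with y hy
  rw [hy]

theorem HasWeakPartialOn.ae_limGradient_eq {O : Set (Space d)} (hO : IsOpen O)
    {j : Fin d} {u g : Space d → ℝ} (h : HasWeakPartialOn O j u g) (hu : LocallyIntegrable u)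
    (hg : LocallyIntegrable g) : ∀ᵐ x, x ∈ O → limGradient u x j = g x := by
  filter_upwards [h.ae_tendsto_partialDeriv_mollify hO hu hg] with x hx hxO
  have := hx hxO
  simp only [ErgodicHO.partialDeriv_mollify _ _ hu, smul_eq_mul] at this
  exact this.limsup_eq

/-- The definition of `limGradient` refers to no ball, and on each ball it agrees almost everywhere
with the local weak derivatives; it therefore glues them together. -/
theorem isWeakGradient_limGradient {u : Space d → ℝ} (hu : LocallyIntegrable u)
    (h : ∀ (m : ℕ) (j : Fin d), ∃ g : Space d → ℝ, LocallyIntegrable g ∧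
      HasWeakPartialOn (Metric.ball 0 m) j u g) : IsWeakGradient u (limGradient u) := by
  choose g hg hw using h
  have hae : ∀ (m : ℕ) (j : Fin d), ∀ᵐ x, x ∈ Metric.ball 0 (m : ℝ) → limGradient u x j = g m j x := fun m j =>
    (hw m j).ae_limGradient_eq Metric.isOpen_ball hu (hg m j)
  have hbd : ∀ K : Set (Space d), IsCompact K → ∃ m : ℕ, K ⊆ Metric.ball 0 (m : ℝ) := by
    intro K hK
    obtain ⟨r, hr⟩ := hK.isBounded.subset_ball 0
    obtain ⟨m, hm⟩ := exists_nat_ge r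
    exact ⟨m, hr.trans (Metric.ball_subset_ball hm)⟩
  have hloc : ∀ j, LocallyIntegrable fun x => limGradient u x j := by
    intro j
    rw [locallyIntegrable_iff]
    intro K hK
    obtain ⟨m, hm⟩ := hbd K hK
    refine ((hg m j).integrableOn_isCompact hK).congr ?_
    filter_upwards [ae_restrict_of_ae (hae m j), ae_restrict_mem hK.measurableSet] with x h1 h2
    exact (h1 (hm h2)).symm
  refine ⟨hu, locallyIntegrable_toLp hloc, fun η hη j => ?_⟩
  obtain ⟨m, hm⟩ := hbd _ hη.hasCompactSupport.isCompact
  have h1 := hw m j η hη hm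
  simp only [smul_eq_mul] at h1
  simp only [mul_comm (u _)]
  rw [h1]
  congr 1
  refine integral_congr_ae ?_
  filter_upwards [hae m j] with x hx
  by_cases hxs : x ∈ tsupport η
  · rw [hx (hm hxs), mul_comm]
  · simp [image_eq_zero_of_notMem_tsupport hxs]

theorem enorm_sq_eq_sum (v : Space d) : ‖v‖ₑ ^ 2 = ∑ j, ‖v j‖ₑ ^ 2 := by
  rw [← ofReal_norm, ← ENNReal.ofReal_pow (norm_nonneg _), EuclideanSpace.norm_sq_eq,
    ENNReal.ofReal_sum_of_nonneg fun i _ => sq_nonneg _]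
  refine Finset.sum_congr rfl fun j _ => ?_
  rw [ENNReal.ofReal_pow (norm_nonneg _), ofReal_norm]

theorem lintegral_limGradient_le {s O : Set (Space d)} (hs : IsAlmostOpen s O)
    {u : Space d → ℝ} (hu : LocallyIntegrable u) {t : Fin d → ℝ≥0∞}
    (h : ∀ j : Fin d, ∃ g : Space d → ℝ, LocallyIntegrable g ∧
      HasWeakPartialOn O j u g ∧ ∫⁻ x, ‖g x‖ₑ ^ 2 ≤ t j) :
    ∫⁻ x in s, ‖limGradient u x‖ₑ ^ 2 ≤ ∑ j, t j := by
  choose g hg hw ht using h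
  calc ∫⁻ x in s, ‖limGradient u x‖ₑ ^ 2 = ∫⁻ x in s, ∑ j, ‖g j x‖ₑ ^ 2 := by
        refine lintegral_congr_ae ?_
        have h1 : ∀ᵐ x, ∀ j, x ∈ O → limGradient u x j = g j x :=
          ae_all_iff.mpr fun j => (hw j).ae_limGradient_eq hs.isOpen hu (hg j)
        have hn : ∀ᵐ x, x ∉ s \ O := measure_eq_zero_iff_ae_notMem.mp hs.measure_diff
        filter_upwards [ae_restrict_of_ae h1, ae_restrict_of_ae hn,
          ae_restrict_mem hs.measurableSet] with x h1 h2 h3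
        rw [enorm_sq_eq_sum]
        refine Finset.sum_congr rfl fun j _ => ?_
        rw [h1 j (by_contra fun hO => h2 ⟨h3, hO⟩)]
    _ = ∑ j, ∫⁻ x in s, ‖g j x‖ₑ ^ 2 :=
        lintegral_finsetSum' _ fun j _ =>
          ((hg j).aestronglyMeasurable.enorm.pow_const 2).restrict
    _ ≤ ∑ j, t j := Finset.sum_le_sum fun j _ => (setLIntegral_le_lintegral _ _).trans (ht j)

theorem IsWeakGradient.congr {f f' : Space d → ℝ} {g : Space d → Space d}
    (h : IsWeakGradient f g) (hf : f =ᵐ[volume] f') : IsWeakGradient f' g where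
  locallyIntegrable := h.locallyIntegrable.congr hf
  locallyIntegrable_grad := h.locallyIntegrable_grad
  integral_eq η hη j := by
    rw [← h.integral_eq η hη j]
    refine integral_congr_ae ?_
    filter_upwards [hf] with x hx
    rw [hx]

theorem IsWeakGradient.ae_eq {f : Space d → ℝ} {g g' : Space d → Space d}
    (h : IsWeakGradient f g) (h' : IsWeakGradient f g') : g =ᵐ[volume] g' := by
  have hcomp : ∀ (g : Space d → Space d), LocallyIntegrable g → ∀ j,
      LocallyIntegrable fun x => g x j := by
    intro g hg j
    refine hg.mono ?_ (Eventually.of_forall fun x => PiLp.norm_apply_le (g x) j)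
    exact (EuclideanSpace.proj (𝕜 := ℝ) j).continuous.comp_aestronglyMeasurable
      hg.aestronglyMeasurable
  have : ∀ j, ∀ᵐ x, g x j = g' x j := by
    intro j
    refine ae_eq_of_integral_contDiff_smul_eq (hcomp g h.locallyIntegrable_grad j)
      (hcomp g' h'.locallyIntegrable_grad j) fun η hη hηs => ?_
    have e := (h.integral_eq η ⟨hη, hηs⟩ j).symm.trans (h'.integral_eq η ⟨hη, hηs⟩ j)
    simpa [mul_comm] using e
  filter_upwards [ae_all_iff.mpr this] with x hx
  ext j
  exact hx j

theorem IsWeakGradient.ae_weakGradient_eq {f : Space d → ℝ} {g : Space d → Space d}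
    (h : IsWeakGradient f g) : weakGradient f =ᵐ[volume] g := by
  have hex : ∃ g, IsWeakGradient f g := ⟨g, h⟩
  rw [weakGradient, dif_pos hex]
  exact hex.choose_spec.ae_eq h

end MollifiedGradient

/-! ### Covariance of the density under translations, and mollified densities as traces. -/

section Shift

variable {d : ℕ}

theorem translation_coeFn (k : Fin d → ℤ) (f : L2 d) :
    translation k f =ᵐ[volume] fun x => f (x + latticeVec k) :=
  Lp.coeFn_compMeasurePreserving f (measurePreserving_add_right volume (latticeVec k))

/-- The density of `U_k A U_k*` is the translate of the density of `A`. -/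
theorem edensity_conj_translation {A : L2 d →L[ℂ] L2 d} (hA : A.IsPositive) (k : Fin d → ℤ) :
    edensity (translation k ∘L A ∘L (translation k).adjoint) =ᵐ[volume]
      fun x => edensity A (x + latticeVec k) := by
  have hA2 := hA.conj_adjoint (translation k)
  -- The two densities are compared through their integrals over all measurable sets. Each is a
  -- Hilbert–Schmidt sum, so the square root of the conjugated operator need not be computed.
  refine ae_eq_of_forall_setLIntegral_eq_of_sigmaFinite (measurable_edensity _)
    ((measurable_edensity A).comp (measurable_add_const _)) fun s hs _ => ?_
  rw [← traceNorm_indicator hA2 hs,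
    traceNorm_of_isPositive (isPositive_mulOp_comp (memLp_top_indicator hs)
      (star_indicator_one s) hA2)]
  set e := basis (L2 d)
  set χ := mulOp (s.indicator (1 : Space d → ℂ)) with hχ
  let S := sqrtOp A ∘L (translation k).adjoint ∘L χ
  have hS : S.adjoint = χ ∘L translation k ∘L sqrtOp A := by
    simp only [S, ContinuousLinearMap.adjoint_comp, ContinuousLinearMap.adjoint_adjoint,
      adjoint_sqrtOp, hχ, adjoint_mulOp_indicator hs]
    rfl
  have h1 : ∀ n, ENNReal.ofReal (inner ℂ (e n)
      ((χ ∘L (translation k ∘L A ∘L (translation k).adjoint) ∘L χ) (e n)) : ℂ).re =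
      ‖S (e n)‖ₑ ^ 2 := by
    intro n
    rw [← ofReal_norm, ← ENNReal.ofReal_pow (norm_nonneg _)]
    simp only [S, ContinuousLinearMap.comp_apply]
    rw [norm_sqrtOp_apply_sq hA, ← ContinuousLinearMap.adjoint_inner_left χ,
      ← ContinuousLinearMap.adjoint_inner_left (translation k), hχ, adjoint_mulOp_indicator hs]
  simp_rw [h1]
  rw [tsum_enorm_apply_sq_adjoint, hS]
  simp_rw [ContinuousLinearMap.comp_apply, enorm_L2_sq]
  rw [← lintegral_tsum fun n => (Lp.aestronglyMeasurable _).enorm.pow_const 2,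
    ← lintegral_indicator hs]
  refine lintegral_congr_ae ?_
  have h2 : ∀ᵐ x, ∀ n, (χ (translation k (sqrtOp A (e n)))) x =
      s.indicator (translation k (sqrtOp A (e n))) x :=
    ae_all_iff.mpr fun n => mulOp_indicator_coeFn hs _
  have h3 : ∀ᵐ x, ∀ n, translation k (sqrtOp A (e n)) x = sqrtOp A (e n) (x + latticeVec k) :=
    ae_all_iff.mpr fun n => translation_coeFn k _
  filter_upwards [h2, h3] with x h2 h3
  by_cases hx : x ∈ s
  · rw [indicator_of_mem hx, edensity]
    refine tsum_congr fun n => ?_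
    rw [← h3 n, ← indicator_of_mem hx (translation k (sqrtOp A (e n))), ← h2 n]
  · rw [indicator_of_notMem hx, ENNReal.tsum_eq_zero]
    intro n
    refine (congrArg (fun z : ℂ => ‖z‖ₑ ^ 2) ((h2 n).trans (indicator_of_notMem hx _))).trans ?_
    simp

/-- The trace formula involves `χ²`; with `χ² = φₙ(x - ·)` the trace of `χAχ` is the mollified
density at `x`. -/
theorem isBoundedCutoff_sqrt_mollifier (n : ℕ) (x : Space d) :
    IsBoundedCutoff fun y => ((√(mollifier d n (x - y)) : ℝ) : ℂ) := by
  have hc : Continuous fun y => ((√(mollifier d n (x - y)) : ℝ) : ℂ) :=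
    Complex.continuous_ofReal.comp (isTest_mollifier_sub n x).continuous.sqrt
  have hs : HasCompactSupport fun y => ((√(mollifier d n (x - y)) : ℝ) : ℂ) :=
    (isTest_mollifier_sub n x).hasCompactSupport.comp_left (g := fun t => ((√t : ℝ) : ℂ)) (by simp)
  exact ⟨hc.memLp_of_hasCompactSupport hs, hs⟩

theorem mollifier_nonneg (n : ℕ) (x : Space d) : 0 ≤ mollifier d n x :=
  (bump d n).nonneg_normed x

/-- Mollified densities are traces. -/
theorem mollify_density_eq {A : L2 d →L[ℂ] L2 d} (hA : A.IsPositive)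
    (h : HasLocallyFiniteDensity A) (n : ℕ) (x : Space d) :
    mollify n (density A) x = (traceNorm (mulOp (fun y => ((√(mollifier d n (x - y)) : ℝ) : ℂ)) ∘L A ∘L
      mulOp (fun y => ((√(mollifier d n (x - y)) : ℝ) : ℂ)))).toReal := by
  rw [traceNorm_mulOp_comp hA (isBoundedCutoff_sqrt_mollifier n x).memLp
    (fun y => Complex.conj_ofReal _), mollify_apply, integral_eq_lintegral_of_nonneg_ae]
  · congr 1
    refine lintegral_congr_ae ?_
    filter_upwards [h.ae_enorm_density] with y hy
    have h0 := mollifier_nonneg n (x - y)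
    rw [← hy, smul_eq_mul, ENNReal.ofReal_mul h0, Real.enorm_eq_ofReal (density_nonneg A y),
      ← ofReal_norm, Complex.norm_real, Real.norm_of_nonneg (Real.sqrt_nonneg _),
      ← ENNReal.ofReal_pow (Real.sqrt_nonneg _), Real.sq_sqrt h0]
  · exact Eventually.of_forall fun y => smul_nonneg (mollifier_nonneg n _) (density_nonneg A y)
  · exact (isTest_mollifier_sub n x).continuous.aestronglyMeasurable.smul
      (measurable_density A).aestronglyMeasurable

end Shift

/-! ### Measurability in `ω`, and the local inequality for random operators. -/

section RandomOperators

set_option linter.unusedSectionVars false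

variable {Ω : Type*} [MeasurableSpace Ω] {d : ℕ} {μ : Measure Ω}

theorem aemeasurable_traceNorm {T : Ω → L2 d →L[ℂ] L2 d} (hpos : ∀ᵐ ω ∂μ, (T ω).IsPositive)
    (hm : ∀ n, AEMeasurable (fun ω => inner ℂ (basis (L2 d) n) (T ω (basis (L2 d) n))) μ) :
    AEMeasurable (fun ω => traceNorm (T ω)) μ := by
  have h : AEMeasurable (fun ω => ∑' n, ENNReal.ofReal
      (inner ℂ (basis (L2 d) n) (T ω (basis (L2 d) n)) : ℂ).re) μ :=
    AEMeasurable.tsum fun n => (Complex.measurable_re.comp_aemeasurable (hm n)).ennreal_ofReal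
  refine h.congr ?_
  filter_upwards [hpos] with ω hω
  exact (traceNorm_of_isPositive hω).symm

theorem measurable_traceNorm {T : Ω → L2 d →L[ℂ] L2 d} (hpos : ∀ ω, (T ω).IsPositive)
    (hm : ∀ n, Measurable fun ω => inner ℂ (basis (L2 d) n) (T ω (basis (L2 d) n))) :
    Measurable fun ω => traceNorm (T ω) := by
  simp_rw [fun ω => traceNorm_of_isPositive (hpos ω)]
  exact Measurable.tsum fun n => (Complex.measurable_re.comp (hm n)).ennreal_ofReal

theorem inner_mulOp_comp {χ : Space d → ℂ} (hχ : MemLp χ ⊤ (volume : Measure (Space d)))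
    (A : L2 d →L[ℂ] L2 d) (u v : L2 d) :
    inner ℂ u ((mulOp χ ∘L A ∘L mulOp χ) v) =
      inner ℂ (mulOp (fun x => star (χ x)) u) (A (mulOp χ v)) := by
  rw [← adjoint_mulOp hχ, ContinuousLinearMap.adjoint_inner_left]
  rfl

/-- Weak measurability can be tested on a Hilbert basis. -/
theorem measurable_inner_of_basis {A : Ω → L2 d →L[ℂ] L2 d} (hpos : ∀ ω, (A ω).IsPositive)
    (hm : ∀ i j, Measurable fun ω => inner ℂ (basis (L2 d) i) (A ω (basis (L2 d) j)))
    (φ ψ : L2 d) : Measurable fun ω => inner ℂ ψ (A ω φ) := by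
  set e := basis (L2 d)
  have h1 : ∀ (ψ : L2 d) j, Measurable fun ω => inner ℂ ψ (A ω (e j)) := by
    intro ψ j
    simp_rw [fun ω => (e.tsum_inner_mul_inner ψ (A ω (e j))).symm]
    exact Measurable.tsum fun i => (hm i j).const_mul _
  have hsa : ∀ ω, inner ℂ ψ (A ω φ) = inner ℂ (A ω ψ) φ := fun ω => by
    rw [← ContinuousLinearMap.adjoint_inner_left, (hpos ω).isSelfAdjoint.adjoint_eq]
  have hsa2 : ∀ ω j, inner ℂ (A ω ψ) (e j) = inner ℂ ψ (A ω (e j)) := fun ω j => by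
    rw [← ContinuousLinearMap.adjoint_inner_left, (hpos ω).isSelfAdjoint.adjoint_eq]
  simp_rw [hsa, fun ω => (e.tsum_inner_mul_inner (A ω ψ) φ).symm, hsa2]
  exact Measurable.tsum fun j => (h1 ψ j).mul_const _

theorem hasLocallyFiniteDensity_zero : HasLocallyFiniteDensity (0 : L2 d →L[ℂ] L2 d) := by
  intro R
  have h : ∀ᵐ x, ∀ n, (sqrtOp (0 : L2 d →L[ℂ] L2 d) (basis (L2 d) n)) x = 0 := by
    refine ae_all_iff.mpr fun n => ?_
    rw [sqrtOp_zero]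
    exact Lp.coeFn_zero _ _ _
  have h2 : ∀ᵐ x, edensity (0 : L2 d →L[ℂ] L2 d) x = 0 := by
    filter_upwards [h] with x hx
    simp [edensity, hx]
  rw [lintegral_congr_ae (ae_restrict_of_ae h2)]
  simp

/-- A weakly measurable, positive, locally trace class family has a version that has these properties
everywhere. -/
theorem exists_good_version {A : Ω → L2 d →L[ℂ] L2 d}
    (hm : ∀ φ ψ : L2 d, AEMeasurable (fun ω => inner ℂ ψ (A ω φ)) μ)
    (hpos : ∀ᵐ ω ∂μ, (A ω).IsPositive) (htr : IsLocallyTraceClass μ A) :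
    ∃ A' : Ω → L2 d →L[ℂ] L2 d, (∀ᵐ ω ∂μ, A' ω = A ω) ∧ (∀ ω, (A' ω).IsPositive) ∧
      (∀ ω, HasLocallyFiniteDensity (A' ω)) ∧
      ∀ φ ψ : L2 d, Measurable fun ω => inner ℂ ψ (A' ω φ) := by
  classical
  set e := basis (L2 d)
  have hfin : ∀ᵐ ω ∂μ, HasLocallyFiniteDensity (A ω) := by
    refine ae_all_iff.mpr fun R => ?_
    have hb : MeasurableSet (Metric.closedBall (0 : Space d) R) := measurableSet_closedBall
    have h1 := htr _ (isBoundedCutoff_indicator hb Metric.isBounded_closedBall)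
    have h2 : AEMeasurable (fun ω => traceNorm
        (mulOp ((Metric.closedBall (0 : Space d) R).indicator 1) ∘L A ω ∘L
          mulOp ((Metric.closedBall (0 : Space d) R).indicator 1))) μ := by
      refine aemeasurable_traceNorm ?_ fun n => ?_
      · filter_upwards [hpos] with ω hω
        exact isPositive_mulOp_comp (memLp_top_indicator hb) (star_indicator_one _) hω
      · simp_rw [inner_mulOp_comp (memLp_top_indicator hb)]
        exact hm _ _
    filter_upwards [ae_lt_top' h2 h1.ne, hpos] with ω h3 h4
    rwa [traceNorm_indicator h4 hb] at h3
  -- Only the countably many matrix elements in the basis are replaced by measurable versions, so a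
  -- single null set suffices.
  have hmk : ∀ᵐ ω ∂μ, ∀ i j, inner ℂ (e i) (A ω (e j)) = (hm (e j) (e i)).mk _ ω :=
    ae_all_iff.mpr fun i => ae_all_iff.mpr fun j => (hm (e j) (e i)).ae_eq_mk
  have hgood := hpos.and (hfin.and hmk)
  -- The exceptional set is enlarged to a measurable null set, so that replacing `A` by zero on it
  -- keeps the matrix elements measurable.
  obtain ⟨N, hN, hNm, hN0⟩ := exists_measurable_superset_of_null (ae_iff.mp hgood)
  have hg : ∀ ω ∉ N, (A ω).IsPositive ∧ HasLocallyFiniteDensity (A ω) ∧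
      ∀ i j, inner ℂ (e i) (A ω (e j)) = (hm (e j) (e i)).mk _ ω := fun ω hω =>
    by_contra fun h => hω (hN h)
  have hp' : ∀ ω, (if ω ∈ N then 0 else A ω).IsPositive := fun ω => by
    split_ifs with h
    · exact ContinuousLinearMap.isPositive_zero
    · exact (hg ω h).1
  refine ⟨fun ω => if ω ∈ N then 0 else A ω, ?_, hp', fun ω => ?_,
    measurable_inner_of_basis hp' fun i j => ?_⟩
  · filter_upwards [measure_eq_zero_iff_ae_notMem.mp hN0] with ω hω
    simp [hω]
  · dsimp only
    split_ifs with h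
    · exact hasLocallyFiniteDensity_zero
    · exact (hg ω h).2.1
  · have : (fun ω => inner ℂ (e i) ((if ω ∈ N then 0 else A ω) (e j))) =
        fun ω => if ω ∈ N then 0 else (hm (e j) (e i)).mk _ ω := by
      ext ω
      split_ifs with h
      · simp
      · exact (hg ω h).2.2 i j
    rw [this]
    exact Measurable.ite hNm measurable_const (hm (e j) (e i)).measurable_mk

/-- A jointly measurable version of the density. -/
def jointDensity (A : Ω → L2 d →L[ℂ] L2 d) (ω : Ω) (x : Space d) : ℝ :=
  limsup (fun n => mollify n (density (A ω)) x) atTop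

theorem ae_jointDensity_eq {A : Ω → L2 d →L[ℂ] L2 d} {ω : Ω}
    (h : HasLocallyFiniteDensity (A ω)) : ∀ᵐ x, jointDensity A ω x = density (A ω) x := by
  filter_upwards [ae_tendsto_mollify h.locallyIntegrable] with x hx
  exact hx.limsup_eq

/-- The defining sum contains `√A(ω)`, while the trace expression uses only matrix elements of
`A(ω)`, whose measurability is known. -/
theorem measurable_mollify_density {A : Ω → L2 d →L[ℂ] L2 d} (hpos : ∀ ω, (A ω).IsPositive)
    (hfin : ∀ ω, HasLocallyFiniteDensity (A ω))
    (hm : ∀ φ ψ : L2 d, Measurable fun ω => inner ℂ ψ (A ω φ)) (n : ℕ) (x : Space d) :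
    Measurable fun ω => mollify n (density (A ω)) x := by
  have e : (fun ω => mollify n (density (A ω)) x) = fun ω => (traceNorm
      (mulOp (fun y => ((√(mollifier d n (x - y)) : ℝ) : ℂ)) ∘L A ω ∘L
        mulOp (fun y => ((√(mollifier d n (x - y)) : ℝ) : ℂ)))).toReal :=
    funext fun ω => mollify_density_eq (hpos ω) (hfin ω) n x
  rw [e]
  have hχ := (isBoundedCutoff_sqrt_mollifier n x).memLp
  refine (measurable_traceNorm (fun ω => isPositive_mulOp_comp hχ
    (fun y => Complex.conj_ofReal _) (hpos ω)) fun i => ?_).ennreal_toReal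
  simp_rw [fun ω => inner_mulOp_comp hχ (A ω) (basis (L2 d) i) (basis (L2 d) i)]
  exact (hm (mulOp (fun y => ((√(mollifier d n (x - y)) : ℝ) : ℂ)) (basis (L2 d) i))
    (mulOp (fun y => star ((√(mollifier d n (x - y)) : ℝ) : ℂ)) (basis (L2 d) i)))

/-- Carathéodory functions are jointly measurable. -/
theorem measurable_of_continuous_of_measurable {u : Space d → Ω → ℝ}
    (hc : ∀ ω, Continuous fun x => u x ω) (hu : ∀ x, Measurable (u x)) :
    Measurable fun p : Ω × Space d => u p.2 p.1 :=
  (measurable_uncurry_of_continuous_of_measurable hc hu).comp measurable_swap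

theorem measurable_jointDensity {A : Ω → L2 d →L[ℂ] L2 d} (hpos : ∀ ω, (A ω).IsPositive)
    (hfin : ∀ ω, HasLocallyFiniteDensity (A ω))
    (hm : ∀ φ ψ : L2 d, Measurable fun ω => inner ℂ ψ (A ω φ)) :
    Measurable fun p : Ω × Space d => jointDensity A p.1 p.2 :=
  Measurable.limsup fun n =>
    measurable_of_continuous_of_measurable (u := fun x ω => mollify n (density (A ω)) x)
      (fun ω => (contDiff_mollify n (hfin ω).locallyIntegrable).continuous)
      (measurable_mollify_density hpos hfin hm n)

theorem measurable_limGradient {u : Ω → Space d → ℝ}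
    (hu : Measurable fun p : Ω × Space d => u p.1 p.2) :
    Measurable fun p : Ω × Space d => limGradient (u p.1) p.2 := by
  refine (PiLp.continuous_toLp 2 fun _ : Fin d => ℝ).measurable.comp
    (measurable_pi_lambda _ fun j => Measurable.limsup fun n => ?_)
  refine StronglyMeasurable.measurable (StronglyMeasurable.integral_prod_right
    (f := fun (p : Ω × Space d) (y : Space d) =>
      partialDeriv j (mollifier d n) (p.2 - y) * u p.1 y) (Measurable.stronglyMeasurable ?_))
  have hc : Continuous (partialDeriv j (mollifier d n)) :=
    ((contDiff_mollifier n).continuous_fderiv (by simp)).clm_apply continuous_const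
  exact (hc.measurable.comp ((measurable_snd.comp measurable_fst).sub measurable_snd)).mul
    (hu.comp ((measurable_fst.comp measurable_fst).prodMk measurable_snd))

section Kinetic

variable {A : Ω → L2 d →L[ℂ] L2 d} {s O : Set (Space d)} {j : Fin d}

theorem isMomentumSandwich_momentumSandwich {A : L2 d →L[ℂ] L2 d} {χ : Space d → ℂ}
    (h : ∃ T, IsMomentumSandwich j A χ T) : IsMomentumSandwich j A χ (momentumSandwich j A χ) := by
  rw [momentumSandwich, dif_pos h]
  exact h.choose_spec

theorem ae_isMomentumSandwich (hkin : HasLocallyFiniteKineticEnergy μ A) (j : Fin d)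
    (h : IsAlmostOpen s O) (hb : Bornology.IsBounded s) :
    ∀ᵐ ω ∂μ, IsMomentumSandwich j (A ω) (s.indicator 1)
      (momentumSandwich j (A ω) (s.indicator 1)) := by
  filter_upwards [(hkin j _ (isBoundedCutoff_indicator h.measurableSet hb)).1] with ω hω
  exact isMomentumSandwich_momentumSandwich hω

/-- The sandwich is chosen separately for each `ω`, so its measurability has to be derived. Its
diagonal matrix elements are limits of `⟨P_j uₘ, A(ω) P_j uₘ⟩` along test functions `uₘ` that do not
depend on `ω`. -/
theorem aemeasurable_traceNorm_momentumSandwich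
    (hm : ∀ φ ψ : L2 d, AEMeasurable (fun ω => inner ℂ ψ (A ω φ)) μ)
    (hpos : ∀ᵐ ω ∂μ, (A ω).IsPositive) (hkin : HasLocallyFiniteKineticEnergy μ A) (j : Fin d)
    (h : IsAlmostOpen s O) (hb : Bornology.IsBounded s) :
    AEMeasurable (fun ω => traceNorm (momentumSandwich j (A ω) (s.indicator 1))) μ := by
  have hS := ae_isMomentumSandwich hkin j h hb
  refine aemeasurable_traceNorm ?_ fun n => ?_
  · filter_upwards [hS, hpos] with ω h1 h2
    exact h1.isPositive h h2
  set v := mulOp (s.indicator 1) (basis (L2 d) n)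
  obtain ⟨u, hu, hlim⟩ := mem_closure_iff_seq_limit.mp (h.mulOp_mem_closure (basis (L2 d) n))
  have hlim2 : ∀ᵐ ω ∂μ, Tendsto (fun m => inner ℂ (testMomentum O j ⟨u m, hu m⟩)
      (A ω (testMomentum O j ⟨u m, hu m⟩))) atTop (𝓝 (inner ℂ (basis (L2 d) n)
        (momentumSandwich j (A ω) (s.indicator 1) (basis (L2 d) n)))) := by
    filter_upwards [hS] with ω hω
    rw [← hω.inner_mulOp h.measurableSet]
    simp_rw [← hω.inner_test h]
    exact hlim.inner (((momentumSandwich j (A ω) (s.indicator 1)).continuous.tendsto _).comp hlim)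
  exact aemeasurable_of_tendsto_metrizable_ae atTop (fun m => hm _ _) hlim2

theorem lintegral_traceNorm_eq (hm : ∀ φ ψ : L2 d, AEMeasurable (fun ω => inner ℂ ψ (A ω φ)) μ)
    (hpos : ∀ᵐ ω ∂μ, (A ω).IsPositive) (hkin : HasLocallyFiniteKineticEnergy μ A) (j : Fin d)
    (h : IsAlmostOpen s O) (hb : Bornology.IsBounded s) :
    ∫⁻ ω, traceNorm (momentumSandwich j (A ω) (s.indicator 1)) ∂μ =
      ENNReal.ofReal (∫ ω, (trace (momentumSandwich j (A ω) (s.indicator 1))).re ∂μ) := by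
  have hmeas := aemeasurable_traceNorm_momentumSandwich hm hpos hkin j h hb
  have hfin := (hkin j _ (isBoundedCutoff_indicator h.measurableSet hb)).2
  have hlt := ae_lt_top' hmeas hfin.ne
  have e : ∀ᵐ ω ∂μ, (trace (momentumSandwich j (A ω) (s.indicator 1))).re =
      (traceNorm (momentumSandwich j (A ω) (s.indicator 1))).toReal := by
    filter_upwards [ae_isMomentumSandwich hkin j h hb, hpos, hlt] with ω h1 h2 h3
    have hp := h1.isPositive h h2
    rw [← ofReal_trace_re hp h3.ne, ENNReal.toReal_ofReal (trace_re_nonneg hp)]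
  rw [integral_congr_ae e, integral_toReal hmeas hlt, ENNReal.ofReal_toReal hfin.ne]

/-- The local Hoffmann-Ostenhof inequality holds almost surely. -/
theorem ae_lintegral_limGradient_le
    (hm : ∀ φ ψ : L2 d, AEMeasurable (fun ω => inner ℂ ψ (A ω φ)) μ)
    (hpos : ∀ᵐ ω ∂μ, (A ω).IsPositive) (hfin : ∀ᵐ ω ∂μ, HasLocallyFiniteDensity (A ω))
    (hkin : HasLocallyFiniteKineticEnergy μ A)
    (h : IsAlmostOpen s O) (hb : Bornology.IsBounded s) :
    ∀ᵐ ω ∂μ, (∀ j, ∃ g : Space d → ℝ, LocallyIntegrable g ∧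
      HasWeakPartialOn O j (fun x => √(density (A ω) x)) g) ∧
      ∫⁻ x in s, ‖limGradient (fun x => √(density (A ω) x)) x‖ₑ ^ 2 ≤
        ∑ j, traceNorm (momentumSandwich j (A ω) (s.indicator 1)) := by
  have hlt : ∀ᵐ ω ∂μ, ∀ j, traceNorm (momentumSandwich j (A ω) (s.indicator 1)) < ⊤ :=
    ae_all_iff.mpr fun j => ae_lt_top' (aemeasurable_traceNorm_momentumSandwich hm hpos hkin j h hb)
      (hkin j _ (isBoundedCutoff_indicator h.measurableSet hb)).2.ne
  have hS := ae_all_iff.mpr fun j => ae_isMomentumSandwich (μ := μ) (A := A) hkin j h hb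
  filter_upwards [hlt, hS, hpos, hfin] with ω h1 h2 h3 h4
  have key := fun j => (h2 j).exists_weakPartial h h3 h4 (h1 j).ne
  refine ⟨fun j => ?_, lintegral_limGradient_le h (locallyIntegrable_sqrt h4.locallyIntegrable) key⟩
  obtain ⟨g, hg, hw, -⟩ := key j
  exact ⟨g, hg, hw⟩

end Kinetic

end RandomOperators

/-! ### Balls and the unit cube are open up to null sets. -/

section Cubes

variable {d : ℕ}

theorem isAlmostOpen_closedBall (m : ℕ) :
    IsAlmostOpen (Metric.closedBall (0 : Space d) (m + 1 : ℕ)) (Metric.ball 0 (m + 1 : ℕ)) where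
  isOpen := Metric.isOpen_ball
  subset := Metric.ball_subset_closedBall
  measurableSet := measurableSet_closedBall
  measure_diff := by
    rw [Metric.closedBall_sdiff_ball]
    -- The radius `m + 1` is nonzero. In dimension `0` the sphere of radius `0` is the whole space,
    -- which is not null.
    exact Measure.addHaar_sphere_of_ne_zero _ _ (by positivity)

theorem isAlmostOpen_unitCube :
    IsAlmostOpen (unitCube d) {x | ∀ i, x i ∈ Ioo (-1 / 2 : ℝ) (1 / 2)} where
  isOpen := by
    simp only [ofPred_forall]
    exact isOpen_iInter_of_finite fun i => isOpen_Ioo.preimage (by fun_prop)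
  subset := fun x hx i => Ioo_subset_Ico_self (hx i)
  measurableSet := by
    simp only [unitCube, ofPred_forall]
    exact MeasurableSet.iInter fun i => measurableSet_Ico.preimage (by fun_prop)
  measure_diff := by
    have h0 : ∀ i : Fin d, volume {x : Space d | x i = -1 / 2} = 0 := fun i => by
      have hp := (PiLp.volume_preserving_ofLp (Fin d)).measure_preimage
        (s := {f : Fin d → ℝ | f i = -1 / 2})
        ((measurableSet_singleton (-1 / 2 : ℝ)).preimage (measurable_pi_apply i)).nullMeasurableSet
      exact hp.trans (Measure.pi_hyperplane (fun _ : Fin d => (volume : Measure ℝ)) i _)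
    refine measure_mono_null (fun x hx => ?_) (measure_iUnion_null h0)
    by_contra hne
    refine hx.2 fun i => ⟨lt_of_le_of_ne (hx.1 i).1 fun he => hne ?_, (hx.1 i).2⟩
    exact mem_iUnion.mpr ⟨i, he.symm⟩

theorem isBounded_unitCube : Bornology.IsBounded (unitCube d) := by
  refine Metric.isBounded_closedBall.subset (t := Metric.closedBall 0 (∑ _i : Fin d, (1 : ℝ)))
    fun x hx => ?_
  rw [mem_closedBall_zero_iff]
  refine (norm_toLp_le_sum x.ofLp).trans (Finset.sum_le_sum fun i _ => ?_)
  rw [Real.norm_eq_abs, abs_le]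
  have := hx i
  exact ⟨by linarith [this.1], by linarith [this.2]⟩

end Cubes

/-! ### Existence and uniqueness of the random density. -/

section Densities

variable {Ω : Type*} [MeasurableSpace Ω] {d : ℕ} {μ : Measure Ω}
  [AddAction (Fin d → ℤ) Ω]

theorem MemL1s.ae_locallyIntegrable {ρ : Ω → Space d → ℝ} (h : MemL1s μ ρ) :
    ∀ᵐ ω ∂μ, LocallyIntegrable (ρ ω) := by
  have hm := h.aestronglyMeasurable.prodMk_left
  have hR : ∀ᵐ ω ∂μ, ∀ R : ℕ, ∫⁻ x in Metric.closedBall 0 (R : ℝ), ‖ρ ω x‖ₑ < ⊤ := by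
    refine ae_all_iff.mpr fun R => ?_
    refine ae_lt_top' ?_ (h.lintegral_lt_top _ (isCompact_closedBall 0 (R : ℝ))).ne
    have h1 : AEMeasurable (fun p : Ω × Space d => ‖ρ p.1 p.2‖ₑ)
        (μ.prod (volume.restrict (Metric.closedBall 0 (R : ℝ)))) :=
      (h.aestronglyMeasurable.mono_ac (Measure.AbsolutelyContinuous.rfl.prod
        Measure.restrict_le_self.absolutelyContinuous)).enorm
    exact h1.lintegral_prod_right'
  filter_upwards [hm, hR] with ω h1 h2
  rw [locallyIntegrable_iff]
  intro K hK
  obtain ⟨r, hr⟩ := hK.isBounded.subset_closedBall 0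
  obtain ⟨R, hR⟩ := exists_nat_ge r
  exact ⟨h1.restrict, (lintegral_mono_set (hr.trans (Metric.closedBall_subset_closedBall hR))).trans_lt
    (h2 R)⟩

theorem integral_sqrt_mollifier_sq (n : ℕ) (x : Space d) (u : Space d → ℝ) :
    ∫ y, ((√(mollifier d n (x - y)) : ℝ) : ℂ) ^ 2 * (u y : ℂ) = ((mollify n u x : ℝ) : ℂ) := by
  rw [mollify_apply, ← integral_complex_ofReal]
  refine integral_congr_ae (Eventually.of_forall fun y => ?_)
  simp only [smul_eq_mul]
  rw [← Complex.ofReal_pow, Real.sq_sqrt (mollifier_nonneg n _), Complex.ofReal_mul]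

/-- Any two versions of the density agree. -/
theorem IsDensity.ae_eq_density {A A' : Ω → L2 d →L[ℂ] L2 d} (hA' : ∀ᵐ ω ∂μ, A' ω = A ω)
    (hpos : ∀ ω, (A' ω).IsPositive) (hfin : ∀ ω, HasLocallyFiniteDensity (A' ω))
    {ρ : Ω → Space d → ℝ} (h : IsDensity μ A ρ) :
    ∀ᵐ ω ∂μ, ρ ω =ᵐ[volume] density (A' ω) := by
  -- The density identity holds almost surely for each cutoff separately. Countably many cutoffs,
  -- centred at a dense sequence, share one null set, and continuity of the mollifications extends
  -- the equality to all points.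
  have h1 : ∀ᵐ ω ∂μ, ∀ n k : ℕ, mollify n (ρ ω) (TopologicalSpace.denseSeq (Space d) k) =
      mollify n (density (A' ω)) (TopologicalSpace.denseSeq (Space d) k) := by
    refine ae_all_iff.mpr fun n => ae_all_iff.mpr fun k => ?_
    set x := TopologicalSpace.denseSeq (Space d) k
    have hχ := isBoundedCutoff_sqrt_mollifier n x
    filter_upwards [h.trace_eq _ hχ, hA'] with ω h1 h2
    have h3 := trace_mulOp_comp (hpos ω) (hfin ω) hχ
    rw [h2] at h3 ⊢
    rw [h1, integral_sqrt_mollifier_sq, integral_sqrt_mollifier_sq] at h3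
    exact Complex.ofReal_injective h3
  filter_upwards [h1, h.toMemL1s.ae_locallyIntegrable] with ω h2 hloc
  have hloc' := (hfin ω).locallyIntegrable
  have h3 : ∀ n, mollify n (ρ ω) = mollify n (density (A' ω)) := fun n =>
    Continuous.ext_on (TopologicalSpace.denseRange_denseSeq (Space d))
      (contDiff_mollify n hloc).continuous (contDiff_mollify n hloc').continuous
      (by rintro _ ⟨k, rfl⟩; exact h2 n k)
  filter_upwards [ae_tendsto_mollify hloc, ae_tendsto_mollify hloc'] with x h4 h5
  simp only [h3] at h4
  exact tendsto_nhds_unique h4 h5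

/-- Passing from almost every fibre to the product measure requires a measurable set, which is where
joint measurability of the version is needed. -/
theorem ae_prod_shift [MeasurableConstVAdd (Fin d → ℤ) Ω] {f : Ω → Space d → ℝ}
    (hf : Measurable fun p : Ω × Space d => f p.1 p.2) (k : Fin d → ℤ)
    (h : ∀ᵐ ω ∂μ, ∀ᵐ x, f (k +ᵥ ω) x = f ω (x + latticeVec k)) :
    ∀ᵐ p ∂(μ.prod (volume : Measure (Space d))), f (k +ᵥ p.1) p.2 = f p.1 (p.2 + latticeVec k) := by
  have hl : Measurable fun p : Ω × Space d => f (k +ᵥ p.1) p.2 :=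
    hf.comp (((measurable_const_vadd k).comp measurable_fst).prodMk measurable_snd)
  have hr : Measurable fun p : Ω × Space d => f p.1 (p.2 + latticeVec k) :=
    hf.comp (measurable_fst.prodMk (measurable_snd.add_const _))
  rwa [Measure.ae_prod_iff_ae_ae (measurableSet_eq_fun hl hr)]

theorem isDensity_jointDensity [MeasurableConstVAdd (Fin d → ℤ) Ω]
    [VAddInvariantMeasure (Fin d → ℤ) Ω μ] {A A' : Ω → L2 d →L[ℂ] L2 d}
    (herg : IsErgodicOperator μ A) (htr : IsLocallyTraceClass μ A) (hA' : ∀ᵐ ω ∂μ, A' ω = A ω)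
    (hpos : ∀ ω, (A' ω).IsPositive) (hfin : ∀ ω, HasLocallyFiniteDensity (A' ω))
    (hm : ∀ φ ψ : L2 d, Measurable fun ω => inner ℂ ψ (A' ω φ)) :
    IsDensity μ A (jointDensity A') where
  aestronglyMeasurable := (measurable_jointDensity hpos hfin hm).aestronglyMeasurable
  shift k := by
    refine ae_prod_shift (measurable_jointDensity hpos hfin hm) k ?_
    -- The good version must agree with `A` at the shifted point as well; invariance of the measure
    -- provides this almost surely.
    have hk := (measurePreserving_vadd k μ).quasiMeasurePreserving.ae hA'
    filter_upwards [hA', hk, herg.shift k] with ω h1 h2 h3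
    rw [← h1, ← h2] at h3
    have hq := (measurePreserving_add_right (volume : Measure (Space d))
      (latticeVec k)).quasiMeasurePreserving.ae (ae_jointDensity_eq (hfin ω))
    filter_upwards [ae_jointDensity_eq (hfin (k +ᵥ ω)), hq,
      edensity_conj_translation (hpos ω) k] with x h4 h5 h6
    rw [h4, h5, ← toReal_edensity, ← toReal_edensity, h3, h6]
  lintegral_lt_top K hK := by
    refine lt_of_le_of_lt (lintegral_mono_ae ?_)
      (htr _ (isBoundedCutoff_indicator hK.measurableSet hK.isBounded))
    filter_upwards [hA'] with ω h1
    rw [← h1, traceNorm_indicator (hpos ω) hK.measurableSet]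
    refine le_of_eq (lintegral_congr_ae (ae_restrict_of_ae ?_))
    filter_upwards [ae_jointDensity_eq (hfin ω), (hfin ω).ae_enorm_density] with x h2 h3
    rw [h2, h3]
  trace_eq χ hχ := by
    filter_upwards [hA'] with ω h1
    rw [← h1, trace_mulOp_comp (hpos ω) (hfin ω) hχ]
    refine integral_congr_ae ?_
    filter_upwards [ae_jointDensity_eq (hfin ω)] with x h2
    rw [h2]

end Densities

/-! ### Assembly: positivity, the `H¹` property and the averaged inequality. -/

section Main

variable {Ω : Type*} [MeasurableSpace Ω] {d : ℕ} {μ : Measure Ω}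

/-- The function is only almost everywhere strongly measurable, so the passage from fibres to the
product is made for a measurable representative. -/
theorem ae_prod_nonneg {ρ : Ω → Space d → ℝ}
    (hm : AEStronglyMeasurable (fun p : Ω × Space d => ρ p.1 p.2) (μ.prod volume))
    (h : ∀ᵐ ω ∂μ, ∀ᵐ x, 0 ≤ ρ ω x) :
    ∀ᵐ p ∂(μ.prod (volume : Measure (Space d))), 0 ≤ ρ p.1 p.2 := by
  have h1 := hm.ae_eq_mk
  have h2 : ∀ᵐ p ∂(μ.prod (volume : Measure (Space d))), 0 ≤ hm.mk _ p := by
    rw [Measure.ae_prod_iff_ae_ae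
      (measurableSet_le measurable_const hm.stronglyMeasurable_mk.measurable)]
    filter_upwards [h, Measure.ae_ae_of_ae_prod h1] with ω h3 h4
    filter_upwards [h3, h4] with x h5 h6
    rwa [← h6]
  filter_upwards [h1, h2] with p h3 h4
  rwa [h3]

theorem measurable_slice {β : Type*} [MeasurableSpace β] {g : Ω → Space d → β}
    (hg : Measurable fun p : Ω × Space d => g p.1 p.2) (ω : Ω) : Measurable (g ω) :=
  hg.comp measurable_prodMk_left

theorem enorm_sqrt_sq_le (t : ℝ) : ‖√t‖ₑ ^ 2 ≤ ‖t‖ₑ := by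
  rw [← ofReal_norm, ← ENNReal.ofReal_pow (norm_nonneg _), ← ofReal_norm]
  refine ENNReal.ofReal_le_ofReal ?_
  rw [Real.norm_of_nonneg (Real.sqrt_nonneg _), Real.norm_eq_abs]
  by_cases ht : 0 ≤ t
  · rw [Real.sq_sqrt ht]; exact le_abs_self t
  · rw [Real.sqrt_eq_zero_of_nonpos (not_le.mp ht).le]; simp

theorem memH1s_sqrt [AddAction (Fin d → ℤ) Ω] {ρ : Ω → Space d → ℝ} (hρ : MemL1s μ ρ)
    {g : Ω → Space d → Space d} (hgm : Measurable fun p : Ω × Space d => g p.1 p.2)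
    (hweak : ∀ᵐ ω ∂μ, IsWeakGradient (fun x => √(ρ ω x)) (g ω))
    (hb : ∀ K : Set (Space d), IsCompact K → ∃ t : Ω → ℝ≥0∞, AEMeasurable t μ ∧
      ∫⁻ ω, t ω ∂μ < ⊤ ∧ ∀ᵐ ω ∂μ, ∫⁻ x in K, ‖g ω x‖ₑ ^ 2 ≤ t ω) :
    MemH1s μ fun ω x => √(ρ ω x) where
  aestronglyMeasurable := hρ.aestronglyMeasurable.aemeasurable.sqrt.aestronglyMeasurable
  shift k := by
    filter_upwards [hρ.shift k] with p hp
    rw [hp]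
  exists_gradient := by
    refine ⟨g, hgm.aestronglyMeasurable, hweak, fun K hK => ?_⟩
    obtain ⟨t, htm, htlt, ht⟩ := hb K hK
    calc ∫⁻ ω, ∫⁻ x in K, (‖√(ρ ω x)‖ₑ ^ 2 + ‖g ω x‖ₑ ^ 2) ∂volume ∂μ
        ≤ ∫⁻ ω, ((∫⁻ x in K, ‖ρ ω x‖ₑ) + t ω) ∂μ := by
          refine lintegral_mono_ae ?_
          filter_upwards [ht] with ω h1
          rw [lintegral_add_right _ ((measurable_slice hgm ω).enorm.pow_const 2)]
          gcongr with x
          exact enorm_sqrt_sq_le _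
      _ < ⊤ := by
          rw [lintegral_add_right' _ htm]
          exact ENNReal.add_lt_top.mpr ⟨hρ.lintegral_lt_top K hK, htlt⟩

variable {A : Ω → L2 d →L[ℂ] L2 d}

theorem ae_isWeakGradient_limGradient
    (hm : ∀ φ ψ : L2 d, AEMeasurable (fun ω => inner ℂ ψ (A ω φ)) μ)
    (hpos : ∀ᵐ ω ∂μ, (A ω).IsPositive) (hfin : ∀ᵐ ω ∂μ, HasLocallyFiniteDensity (A ω))
    (hkin : HasLocallyFiniteKineticEnergy μ A) :
    ∀ᵐ ω ∂μ, IsWeakGradient (fun x => √(density (A ω) x))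
      (limGradient fun x => √(density (A ω) x)) := by
  have hballs := ae_all_iff.mpr fun m : ℕ => ae_lintegral_limGradient_le hm hpos hfin hkin
    (isAlmostOpen_closedBall (d := d) m) Metric.isBounded_closedBall
  filter_upwards [hballs, hfin] with ω h1 h2
  refine isWeakGradient_limGradient (locallyIntegrable_sqrt h2.locallyIntegrable) fun m j => ?_
  obtain ⟨g, hg, hw⟩ := (h1 m).1 j
  refine ⟨g, hg, fun η hη hηO => hw η hη (hηO.trans (Metric.ball_subset_ball ?_))⟩
  exact_mod_cast Nat.le_succ m

theorem exists_bound_lintegral_limGradient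
    (hm : ∀ φ ψ : L2 d, AEMeasurable (fun ω => inner ℂ ψ (A ω φ)) μ)
    (hpos : ∀ᵐ ω ∂μ, (A ω).IsPositive) (hfin : ∀ᵐ ω ∂μ, HasLocallyFiniteDensity (A ω))
    (hkin : HasLocallyFiniteKineticEnergy μ A) {K : Set (Space d)} (hK : IsCompact K) :
    ∃ t : Ω → ℝ≥0∞, AEMeasurable t μ ∧ ∫⁻ ω, t ω ∂μ < ⊤ ∧
      ∀ᵐ ω ∂μ, ∫⁻ x in K, ‖limGradient (fun x => √(density (A ω) x)) x‖ₑ ^ 2 ≤ t ω := by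
  obtain ⟨r, hr⟩ := hK.isBounded.subset_closedBall 0
  obtain ⟨m, hr'⟩ := exists_nat_ge r
  have hKm : K ⊆ Metric.closedBall 0 ((m + 1 : ℕ) : ℝ) :=
    hr.trans (Metric.closedBall_subset_closedBall (hr'.trans (by exact_mod_cast Nat.le_succ m)))
  have hs := isAlmostOpen_closedBall (d := d) m
  have hsb : Bornology.IsBounded (Metric.closedBall (0 : Space d) ((m + 1 : ℕ) : ℝ)) :=
    Metric.isBounded_closedBall
  have htm := fun j => aemeasurable_traceNorm_momentumSandwich hm hpos hkin j hs hsb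
  refine ⟨_, Finset.aemeasurable_fun_sum Finset.univ fun j _ => htm j, ?_, ?_⟩
  · rw [lintegral_finsetSum' _ fun j _ => htm j]
    exact ENNReal.sum_lt_top.mpr fun j _ =>
      (hkin j _ (isBoundedCutoff_indicator hs.measurableSet hsb)).2
  · filter_upwards [ae_lintegral_limGradient_le hm hpos hfin hkin hs hsb] with ω h1
    exact (lintegral_mono_set hKm).trans h1.2

theorem lintegral_limGradient_unitCube_le
    (hm : ∀ φ ψ : L2 d, AEMeasurable (fun ω => inner ℂ ψ (A ω φ)) μ)
    (hpos : ∀ᵐ ω ∂μ, (A ω).IsPositive) (hfin : ∀ᵐ ω ∂μ, HasLocallyFiniteDensity (A ω))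
    (hkin : HasLocallyFiniteKineticEnergy μ A) :
    ∫⁻ ω, ∫⁻ x in unitCube d, ‖limGradient (fun y => √(density (A ω) y)) x‖ₑ ^ 2 ∂volume ∂μ ≤
      ENNReal.ofReal (kineticEnergyPerUnitVolume μ A) := by
  have hQ := isAlmostOpen_unitCube (d := d)
  have hQb := isBounded_unitCube (d := d)
  calc ∫⁻ ω, ∫⁻ x in unitCube d, ‖limGradient (fun y => √(density (A ω) y)) x‖ₑ ^ 2 ∂volume ∂μ
      ≤ ∫⁻ ω, ∑ j, traceNorm (momentumSandwich j (A ω) ((unitCube d).indicator 1)) ∂μ := by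
        refine lintegral_mono_ae ?_
        filter_upwards [ae_lintegral_limGradient_le hm hpos hfin hkin hQ hQb] with ω h1
        exact h1.2
    _ = ENNReal.ofReal (kineticEnergyPerUnitVolume μ A) := by
        rw [lintegral_finsetSum' _ fun j _ =>
          aemeasurable_traceNorm_momentumSandwich hm hpos hkin j hQ hQb,
          kineticEnergyPerUnitVolume, ENNReal.ofReal_sum_of_nonneg]
        · exact Finset.sum_congr rfl fun j _ => lintegral_traceNorm_eq hm hpos hkin j hQ hQb
        · intro j _
          refine integral_nonneg_of_ae ?_
          filter_upwards [ae_isMomentumSandwich hkin j hQ hQb, hpos] with ω h1 h2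
          exact trace_re_nonneg (h1.isPositive hQ h2)

end Main

end ErgodicHO

end

open ErgodicHO
theorem proposition2p5 {Ω : Type*} [MeasurableSpace Ω] (μ : Measure Ω) [IsProbabilityMeasure μ]
    (d : ℕ) [AddAction (Fin d → ℤ) Ω] [MeasurableConstVAdd (Fin d → ℤ) Ω]
    [ErgodicVAdd (Fin d → ℤ) Ω μ]
    (A : Ω → L2 d →L[ℂ] L2 d)
    (hA_erg : IsErgodicOperator μ A)
    (hA_pos : ∀ᵐ ω ∂μ, (A ω).IsPositive)
    (hA_tr : IsLocallyTraceClass μ A)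
    (hA_kin : HasLocallyFiniteKineticEnergy μ A) :
    (∃ ρ : Ω → Space d → ℝ, IsDensity μ A ρ) ∧
    ∀ ρ : Ω → Space d → ℝ, IsDensity μ A ρ →
      (∀ᵐ p ∂(μ.prod (volume : Measure (Space d))), 0 ≤ ρ p.1 p.2) ∧
      MemH1s μ (fun ω x => √(ρ ω x)) ∧
      ∫⁻ ω, ∫⁻ x in unitCube d, ‖weakGradient (fun y => √(ρ ω y)) x‖ₑ ^ 2 ∂volume ∂μ ≤
        ENNReal.ofReal (kineticEnergyPerUnitVolume μ A) := by
  obtain ⟨A', hA', hpos, hfin, hm⟩ := exists_good_version hA_erg.aemeasurable hA_pos hA_tr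
  refine ⟨⟨_, isDensity_jointDensity hA_erg hA_tr hA' hpos hfin hm⟩, fun ρ hρ => ?_⟩
  have heq := hρ.ae_eq_density hA' hpos hfin
  have hfinA : ∀ᵐ ω ∂μ, HasLocallyFiniteDensity (A ω) := by
    filter_upwards [hA'] with ω h
    rw [← h]
    exact hfin ω
  have hmA := hA_erg.aemeasurable
  have hsqrt : ∀ᵐ ω ∂μ, (fun x => √(density (A ω) x)) =ᵐ[volume] fun x => √(ρ ω x) := by
    filter_upwards [heq, hA'] with ω h1 h2
    filter_upwards [h1] with x hx
    rw [hx, h2]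
  -- The gradient is built from `jointDensity A'`, which is jointly measurable, and afterwards
  -- identified almost surely with the one built from `density (A ω)`.
  have hgm : Measurable fun p : Ω × Space d =>
      limGradient (fun x => √(jointDensity A' p.1 x)) p.2 :=
    measurable_limGradient (u := fun ω x => √(jointDensity A' ω x))
      (measurable_jointDensity hpos hfin hm).sqrt
  have hg : ∀ᵐ ω ∂μ, limGradient (fun x => √(jointDensity A' ω x)) =
      limGradient fun x => √(density (A ω) x) := by
    filter_upwards [hA'] with ω h
    refine limGradient_congr ?_
    filter_upwards [ae_jointDensity_eq (hfin ω)] with x hx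
    rw [hx, h]
  have hgrad := ae_isWeakGradient_limGradient hmA hA_pos hfinA hA_kin
  refine ⟨ae_prod_nonneg hρ.aestronglyMeasurable ?_,
    memH1s_sqrt (g := fun ω => limGradient fun x => √(jointDensity A' ω x)) hρ.toMemL1s hgm ?_
      fun K hK => ?_, le_trans (lintegral_mono_ae ?_)
    (lintegral_limGradient_unitCube_le hmA hA_pos hfinA hA_kin)⟩
  · filter_upwards [heq] with ω h
    filter_upwards [h] with x hx
    rw [hx]
    exact density_nonneg _ x
  · filter_upwards [hgrad, hg, hsqrt] with ω h1 h2 h3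
    rw [h2]
    exact h1.congr h3
  · obtain ⟨t, htm, htlt, ht⟩ := exists_bound_lintegral_limGradient hmA hA_pos hfinA hA_kin hK
    refine ⟨t, htm, htlt, ?_⟩
    filter_upwards [ht, hg] with ω h1 h2
    rw [h2]
    exact h1
  -- `weakGradient` is an arbitrary choice; uniqueness of weak gradients identifies it almost
  -- everywhere with `limGradient`.
  · filter_upwards [hgrad, hsqrt] with ω h1 h2
    refine le_of_eq (lintegral_congr_ae (ae_restrict_of_ae ?_))
    filter_upwards [(h1.congr h2).ae_weakGradient_eq] with x hx
    rw [hx]
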